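/- Let $k$ be an algebraically closed field of characteristic $0$ and let $H$ be a semisimple Hopf algebra over $k$, with counit $\varepsilon$. Let $\mathcal{C}=\mathrm{Rep}(H)$ be the fusion category of finite-dimensional representations of $H$, with Grothendieck ring $R=K_0(\mathcal{C})$, whose basic elements are the classes $[X]$ of the simple objects $X$. Let $\mathcal{C}_{ad}\subseteq\mathcal{C}$ be the full tensor subcategory generated by all subobjects of $X\otimes X^*$, $X$ simple. A subgroup of $R$ is called based if it is the $\mathbb{Z}$-span of a set of basic elements. Let $R_{ad}$ be the smallest based subring of $R$ that contains $[X][X^*]$ for all simple $X$, and let $R=\bigoplus_{a\in U(\mathcal{C})}R_a$ be the decomposition of $R$ into indecomposable based $R_{ad}$-subbimodules. The index set $U(\mathcal{C})$ is a finite group, the universal grading group of $\mathcal{C}$, in which $ab=c$ if and only if $R_aR_b\subseteq R_c$. For a finite group $G$, let $\mathrm{Fun}(G)$ be the Hopf algebra of $k$-valued functions on $G$, with pointwise multiplication and $(\Delta f)(x,y)=f(xy)$. Then there exists a unique Hopf subalgebra $K$ of $H$ which is contained in the center of $H$ and is maximal with respect to this property. Moreover: 1. Let $K^+=K\cap\ker\varepsilon$.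 Then $HK^+$ is a Hopf ideal of $H$, and with $H_{ad}:=H/HK^+$ one has $\mathcal{C}_{ad}=\mathrm{Rep}(H_{ad})$; that is, restriction along $H\to H_{ad}$ is a fully faithful tensor functor $\mathrm{Rep}(H_{ad})\to\mathrm{Rep}(H)$ with essential image $\mathcal{C}_{ad}$. 2. $K=\mathrm{Fun}(U(\mathcal{C}))$; that is, there is an injective homomorphism of Hopf algebras $\varphi:\mathrm{Fun}(U(\mathcal{C}))\to H$ with image $K$, such that $\varphi(f)$ acts by the scalar $f(a)$ on each simple object $X$ with $[X]\in R_a$. -/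

import Mathlib

open CategoryTheory MonoidalCategory TensorProduct

universe u v w

/-! ### Based rings and fusion categories -/

section BasedRing

variable {R ι : Type*} [Ring R] (b d : ι → R)

/-- For a family `b` of basic elements of `R`: `M` is the `ℤ`-span of a set of basic elements. -/
def IsBasedSubgroup (M : AddSubgroup R) : Prop :=
  ∃ s : Set ι, M = AddSubgroup.closure (b '' s)

/-- The adjoint subring `R_ad` of a ring `R` with basic elements `b i` and their duals
`d i = (b i)*`: the smallest subring that is spanned by basic elements and contains all the products
`X X*`, `X` basic. -/
def adjointSubring : Subring R :=
  sInf {S | IsBasedSubgroup b S.toAddSubgroup ∧ ∀ i, b i * d i ∈ S}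

/-- Based `R_ad`-subbimodules of `R`. -/
structure IsBasedSubbimodule (M : AddSubgroup R) : Prop where
  based : IsBasedSubgroup b M
  left : ∀ r ∈ adjointSubring b d, ∀ m ∈ M, r * m ∈ M
  right : ∀ r ∈ adjointSubring b d, ∀ m ∈ M, m * r ∈ M

/-- Indecomposable based `R_ad`-subbimodules of `R`: nonzero ones that are not the direct sum of two
nonzero based subbimodules. These are exactly the components `R_a` of the decomposition of `R` into a
direct sum of indecomposable based `R_ad`-bimodules. -/
structure IsIndecomposableSubbimodule (M : AddSubgroup R) : Prop where
  subbimodule : IsBasedSubbimodule b d M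
  ne_bot : M ≠ ⊥
  indecomposable : ∀ M₁ M₂ : AddSubgroup R, IsBasedSubbimodule b d M₁ →
    IsBasedSubbimodule b d M₂ → M₁ ⊔ M₂ = M → M₁ ⊓ M₂ = ⊥ → M₁ = ⊥ ∨ M₂ = ⊥

end BasedRing

section FusionCategory

variable (C : Type u) [Category.{v} C] [Preadditive C] [MonoidalCategory C]

variable {C} in
/-- `Z` is a direct sum of `X` and `Y`. -/
def IsDirectSum (Z X Y : C) : Prop :=
  ∃ (i : X ⟶ Z) (j : Y ⟶ Z) (p : Z ⟶ X) (q : Z ⟶ Y),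
    i ≫ p = 𝟙 X ∧ j ≫ q = 𝟙 Y ∧ i ≫ q = 0 ∧ j ≫ p = 0 ∧ p ≫ i + q ≫ j = 𝟙 Z

/-- The relations `[X ⊕ Y] = [X] + [Y]` in the monoid ring of the monoid (under `⊗`) of isomorphism
classes of objects. -/
noncomputable def directSumIdeal : TwoSidedIdeal (MonoidAlgebra ℤ (Skeleton C)) :=
  TwoSidedIdeal.span {a | ∃ Z X Y : C, IsDirectSum Z X Y ∧
    a = MonoidAlgebra.of ℤ _ (toSkeleton Z) -
      (MonoidAlgebra.of ℤ _ (toSkeleton X) + MonoidAlgebra.of ℤ _ (toSkeleton Y))}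

/-- The Grothendieck ring of a semisimple tensor category: generated by the isomorphism classes `[X]`
of objects, with `[X ⊕ Y] = [X] + [Y]` and `[X ⊗ Y] = [X] [Y]`. -/
def GrothendieckRing : Type u :=
  MonoidAlgebra ℤ (Skeleton C) ⧸ (directSumIdeal C).asIdeal

noncomputable instance : Ring (GrothendieckRing C) :=
  inferInstanceAs (Ring (MonoidAlgebra ℤ (Skeleton C) ⧸ (directSumIdeal C).asIdeal))

variable {C} in
/-- The class `[X]` of an object in the Grothendieck ring. -/
noncomputable def objClass (X : C) : GrothendieckRing C :=
  Ideal.Quotient.mk (directSumIdeal C).asIdeal (MonoidAlgebra.of ℤ _ (toSkeleton X))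

/-- The basic elements of the Grothendieck ring are the classes of the simple objects. (The index is
a simple object rather than an isomorphism class.) -/
noncomputable def basic (X : {X : C // Simple X}) : GrothendieckRing C := objClass X.1

variable [RightRigidCategory C]

/-- The classes `[X*]` dual to the basic elements `[X]`. -/
noncomputable def basicDual (X : {X : C // Simple X}) : GrothendieckRing C := objClass (X.1ᘁ)

/-- The underlying set of the universal grading group `U(C)`: the components `R_a` of
the Grothendieck ring `R` of `C`. -/
def UniversalGrading : Type u :=
  {M : AddSubgroup (GrothendieckRing C) //
    IsIndecomposableSubbimodule (basic C) (basicDual C) M}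

variable {C} in
/-- The subgroup `R_a` of the Grothendieck ring. -/
def UniversalGrading.component (a : UniversalGrading C) : AddSubgroup (GrothendieckRing C) := a.1

/-- A group structure on `U(C)` is the universal grading group structure if `ab = c` is equivalent to
`R_a R_b ⊆ R_c`. Such a group structure is unique, as its multiplication is determined. -/
def IsUniversalGradingGroup [Group (UniversalGrading C)] : Prop :=
  ∀ a b c : UniversalGrading C, a * b = c ↔
    ∀ x ∈ a.component, ∀ y ∈ b.component, x * y ∈ c.component

variable {C} in
/-- A full tensor subcategory of a fusion category, given by its objects. -/
structure IsFusionSubcategory (P : ObjectProperty C) : Prop where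
  iso : P.IsClosedUnderIsomorphisms
  unit : P (𝟙_ C)
  tensor : ∀ X Y : C, P X → P Y → P (X ⊗ Y)
  dual : ∀ X : C, P X → P (Xᘁ)
  directSum : ∀ Z X Y : C, IsDirectSum Z X Y → P X → P Y → P Z
  subobject : ∀ (X Y : C) (f : X ⟶ Y), Mono f → P Y → P X

/-- The adjoint subcategory `C_ad`: the full tensor subcategory generated by all
subobjects of `X ⊗ X*`, where `X` runs through the simple objects. -/
def adjointSubcategory : ObjectProperty C := fun Y =>
  ∀ P : ObjectProperty C, IsFusionSubcategory P →
    (∀ (X : C) (_ : Simple X) (Z : C) (f : Z ⟶ X ⊗ Xᘁ), Mono f → P Z) → P Y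

end FusionCategory

/-! ### The fusion category of representations of a Hopf algebra -/

/-- A finite-dimensional representation of the `k`-algebra `H`. (Every finite-dimensional vector
space over `k : Type u` has an isomorphic copy in `Type u`, so there is no restriction here.) -/
structure HopfRep (k : Type u) (H : Type v) [Field k] [Ring H] [Algebra k H] where
  V : Type u
  [addCommGroup : AddCommGroup V]
  [module : Module k V]
  [finite : Module.Finite k V]
  ρ : H →ₐ[k] Module.End k V

namespace HopfRep

attribute [instance] addCommGroup module finite

section Category

variable {k : Type u} {H : Type v} [Field k] [Ring H] [Algebra k H]

/-- The `H`-equivariant linear maps. -/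
def intertwiners (X Y : HopfRep.{u, v} k H) : Submodule k (X.V →ₗ[k] Y.V) where
  carrier := {f | ∀ h : H, f ∘ₗ X.ρ h = Y.ρ h ∘ₗ f}
  add_mem' {f g} hf hg h := by rw [LinearMap.add_comp, LinearMap.comp_add, hf h, hg h]
  zero_mem' h := by simp
  smul_mem' c f hf h := by rw [LinearMap.smul_comp, LinearMap.comp_smul, hf h]

instance : Category (HopfRep.{u, v} k H) where
  Hom X Y := intertwiners X Y
  id X := ⟨LinearMap.id, fun _ => rfl⟩
  comp f g := ⟨g.1 ∘ₗ f.1, fun h => by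
    rw [LinearMap.comp_assoc, f.2 h, ← LinearMap.comp_assoc, g.2 h, LinearMap.comp_assoc]⟩

/-- The linear map underlying a morphism. -/
def linearMap {X Y : HopfRep.{u, v} k H} (f : X ⟶ Y) : X.V →ₗ[k] Y.V := f.1

theorem linearMap_comm {X Y : HopfRep.{u, v} k H} (f : X ⟶ Y) (h : H) (x : X.V) :
    linearMap f (X.ρ h x) = Y.ρ h (linearMap f x) := LinearMap.congr_fun (f.2 h) x

/-- The morphism given by an equivariant linear map. -/
def homMk {X Y : HopfRep.{u, v} k H} (f : X.V →ₗ[k] Y.V)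
    (hf : ∀ h : H, f ∘ₗ X.ρ h = Y.ρ h ∘ₗ f) : X ⟶ Y := ⟨f, hf⟩

theorem hom_ext {X Y : HopfRep.{u, v} k H} {f g : X ⟶ Y} (h : linearMap f = linearMap g) :
    f = g := Subtype.ext h

/-- The isomorphism given by an equivariant linear equivalence. -/
def isoMk {X Y : HopfRep.{u, v} k H} (e : X.V ≃ₗ[k] Y.V)
    (he : ∀ h : H, e.toLinearMap ∘ₗ X.ρ h = Y.ρ h ∘ₗ e.toLinearMap) : X ≅ Y where
  hom := homMk e.toLinearMap he
  inv := homMk e.symm.toLinearMap fun h => by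
    ext y
    have := LinearMap.congr_fun (he h) (e.symm y)
    simp only [LinearMap.comp_apply, LinearEquiv.coe_coe, LinearEquiv.apply_symm_apply] at this ⊢
    rw [← this, LinearEquiv.symm_apply_apply]
  hom_inv_id := Subtype.ext (LinearMap.ext fun x => e.symm_apply_apply x)
  inv_hom_id := Subtype.ext (LinearMap.ext fun x => e.apply_symm_apply x)

instance : Preadditive (HopfRep.{u, v} k H) where
  homGroup X Y := inferInstanceAs (AddCommGroup (intertwiners X Y))
  add_comp _ _ _ f f' g := Subtype.ext (LinearMap.comp_add f.1 f'.1 g.1)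
  comp_add _ _ _ f g g' := Subtype.ext (LinearMap.add_comp f.1 g'.1 g.1)

end Category


section TensorAct

variable {k A B C V W U : Type*} [Field k] [Ring A] [Algebra k A] [Ring B] [Algebra k B]
  [Ring C] [Algebra k C] [AddCommGroup V] [Module k V] [AddCommGroup W] [Module k W]
  [AddCommGroup U] [Module k U]

/-- The action of `A ⊗ B` on `V ⊗ W` given by actions of `A` on `V` and of `B` on `W`. -/
noncomputable def tensorAct (f : A →ₐ[k] Module.End k V) (g : B →ₐ[k] Module.End k W) :
    A ⊗[k] B →ₐ[k] Module.End k (V ⊗[k] W) :=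
  Module.endTensorEndAlgHom.comp (Algebra.TensorProduct.map f g)

theorem tensorAct_tmul (f : A →ₐ[k] Module.End k V) (g : B →ₐ[k] Module.End k W) (a : A)
    (b : B) : tensorAct f g (a ⊗ₜ b) = TensorProduct.map (f a) (g b) := rfl

theorem tensorAct_map {V' W' : Type*} [AddCommGroup V'] [Module k V'] [AddCommGroup W']
    [Module k W'] {f : A →ₐ[k] Module.End k V} {f' : A →ₐ[k] Module.End k V'}
    {g : B →ₐ[k] Module.End k W} {g' : B →ₐ[k] Module.End k W'} (p : V →ₗ[k] V')
    (hp : ∀ a, p ∘ₗ f a = f' a ∘ₗ p) (q : W →ₗ[k] W') (hq : ∀ b, q ∘ₗ g b = g' b ∘ₗ q)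
    (t : A ⊗[k] B) :
    TensorProduct.map p q ∘ₗ tensorAct f g t = tensorAct f' g' t ∘ₗ TensorProduct.map p q := by
  induction t with
  | zero => simp
  | add s t hs ht => simp only [map_add, LinearMap.comp_add, LinearMap.add_comp, hs, ht]
  | tmul a b =>
    rw [tensorAct_tmul, tensorAct_tmul, ← TensorProduct.map_comp, ← TensorProduct.map_comp,
      hp a, hq b]

theorem tensorAct_assoc (f : A →ₐ[k] Module.End k V) (g : B →ₐ[k] Module.End k W)
    (e : C →ₐ[k] Module.End k U) (t : (A ⊗[k] B) ⊗[k] C) :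
    (TensorProduct.assoc k V W U).toLinearMap ∘ₗ tensorAct (tensorAct f g) e t =
      tensorAct f (tensorAct g e) (TensorProduct.assoc k A B C t) ∘ₗ
        (TensorProduct.assoc k V W U).toLinearMap := by
  induction t with
  | zero => simp
  | add s t hs ht => simp only [map_add, LinearMap.comp_add, LinearMap.add_comp, hs, ht]
  | tmul a b =>
    induction a with
    | zero => simp
    | add s t hs ht =>
      simp only [TensorProduct.add_tmul, map_add, LinearMap.comp_add, LinearMap.add_comp, hs, ht]
    | tmul a c =>
      apply TensorProduct.ext_threefold
      intro x y z
      rfl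

theorem tensorAct_comp_left (d : C →ₐ[k] A) (f : A →ₐ[k] Module.End k V)
    (g : B →ₐ[k] Module.End k W) (t : C ⊗[k] B) :
    tensorAct (f.comp d) g t = tensorAct f g (d.toLinearMap.rTensor B t) := by
  induction t with
  | zero => simp
  | add s t hs ht => simp only [map_add, hs, ht]
  | tmul a b => rfl

theorem tensorAct_comp_right (d : C →ₐ[k] B) (f : A →ₐ[k] Module.End k V)
    (g : B →ₐ[k] Module.End k W) (t : A ⊗[k] C) :
    tensorAct f (g.comp d) t = tensorAct f g (d.toLinearMap.lTensor A t) := by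
  induction t with
  | zero => simp
  | add s t hs ht => simp only [map_add, hs, ht]
  | tmul a b => rfl

theorem tensorAct_lid (e : A →ₐ[k] k) (g : B →ₐ[k] Module.End k W) (t : A ⊗[k] B) :
    (TensorProduct.lid k W).toLinearMap ∘ₗ tensorAct ((Algebra.lmul k k).comp e) g t =
      g (TensorProduct.lid k B (e.toLinearMap.rTensor B t)) ∘ₗ
        (TensorProduct.lid k W).toLinearMap := by
  induction t with
  | zero => simp
  | add s t hs ht => simp only [map_add, LinearMap.comp_add, LinearMap.add_comp, hs, ht]
  | tmul a b =>
    apply TensorProduct.ext'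
    intro c x
    simp [tensorAct_tmul, mul_smul]

theorem tensorAct_rid (e : B →ₐ[k] k) (f : A →ₐ[k] Module.End k V) (t : A ⊗[k] B) :
    (TensorProduct.rid k V).toLinearMap ∘ₗ tensorAct f ((Algebra.lmul k k).comp e) t =
      f (TensorProduct.rid k A (e.toLinearMap.lTensor A t)) ∘ₗ
        (TensorProduct.rid k V).toLinearMap := by
  induction t with
  | zero => simp
  | add s t hs ht => simp only [map_add, LinearMap.comp_add, LinearMap.add_comp, hs, ht]
  | tmul a b =>
    apply TensorProduct.ext'
    intro x c
    simp [tensorAct_tmul, mul_smul]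

end TensorAct

section DualAct

variable {k H V : Type*} [Field k] [Ring H] [HopfAlgebra k H] [AddCommGroup V] [Module k V]

/-- The action of `H` on the dual space `V* = Hom(V, k)` by `(h • f)(v) = f(S(h) v)`. -/
noncomputable def dualAct (ρ : H →ₐ[k] Module.End k V) :
    H →ₐ[k] Module.End k (Module.Dual k V) :=
  AlgHom.ofLinearMap
    ((Module.Dual.transpose (R := k) (M := V) (M' := V)) ∘ₗ ρ.toLinearMap ∘ₗ
      HopfAlgebra.antipode k)
    (by
      apply LinearMap.ext; intro f; apply LinearMap.ext; intro x
      simp [Module.Dual.transpose_apply])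
    (fun a b => by
      apply LinearMap.ext; intro f; apply LinearMap.ext; intro x
      simp [HopfAlgebra.antipode_mul_antidistrib, Module.Dual.transpose_apply])

theorem dualAct_apply (ρ : H →ₐ[k] Module.End k V) (h : H) (f : Module.Dual k V) (x : V) :
    dualAct ρ h f x = f (ρ (HopfAlgebra.antipode k h) x) := rfl

theorem contractLeft_tensorAct (ρ : H →ₐ[k] Module.End k V) (t : H ⊗[k] H)
    (f : Module.Dual k V) (x : V) :
    contractLeft k V (tensorAct (dualAct ρ) ρ t (f ⊗ₜ x)) =
      f (ρ (LinearMap.mul' k H ((HopfAlgebra.antipode k).rTensor H t)) x) := by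
  induction t with
  | zero => simp
  | add s t hs ht => simp only [map_add, LinearMap.add_apply, hs, ht]
  | tmul a b =>
    rw [LinearMap.rTensor_tmul, LinearMap.mul'_apply, map_mul]
    rfl

theorem coevaluation_slide [FiniteDimensional k V] (T : Module.End k V) :
    TensorProduct.map LinearMap.id (Module.Dual.transpose T) (coevaluation k V 1) =
      TensorProduct.map T LinearMap.id (coevaluation k V 1) := by
  apply (TensorProduct.comm k V (Module.Dual k V)).injective
  apply (dualTensorHomEquiv k V V).injective
  apply LinearMap.ext
  intro y
  change dualTensorHom k V V _ y = dualTensorHom k V V _ y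
  rw [coevaluation_apply_one]
  have hy := (Module.Basis.ofVectorSpace k V).sum_repr y
  have hT := (Module.Basis.ofVectorSpace k V).sum_repr (T y)
  simp only [map_sum, TensorProduct.map_tmul, TensorProduct.comm_tmul, LinearMap.sum_apply,
    dualTensorHom_apply, LinearMap.id_apply,
    Module.Dual.transpose_apply, LinearMap.comp_apply, Module.Basis.coord_apply]
  rw [hT]
  conv_lhs => rw [← hy]
  simp only [map_sum, map_smul]

theorem tensorAct_coevaluation [FiniteDimensional k V] (ρ : H →ₐ[k] Module.End k V)
    (t : H ⊗[k] H) :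
    tensorAct ρ (dualAct ρ) t (coevaluation k V 1) =
      TensorProduct.map (ρ (LinearMap.mul' k H ((HopfAlgebra.antipode k).lTensor H t)))
        LinearMap.id (coevaluation k V 1) := by
  induction t with
  | zero => simp
  | add s t hs ht =>
    simp only [map_add, LinearMap.add_apply, hs, ht, TensorProduct.map_add_left]
  | tmul a b =>
    have h := congrArg (TensorProduct.map (ρ a) LinearMap.id)
      (coevaluation_slide (ρ (HopfAlgebra.antipode k b)))
    rw [LinearMap.lTensor_tmul, LinearMap.mul'_apply, map_mul]
    rw [TensorProduct.map_map, TensorProduct.map_map, LinearMap.comp_id, LinearMap.id_comp,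
      LinearMap.id_comp] at h
    exact h

end DualAct


section Tensor

variable {k : Type u} {H : Type v} [Field k] [Ring H] [Bialgebra k H]

/-- The tensor product `X ⊗ Y`, on which `h` acts through `Δ h ∈ H ⊗ H`. -/
noncomputable def tensor (X Y : HopfRep.{u, v} k H) : HopfRep.{u, v} k H where
  V := X.V ⊗[k] Y.V
  ρ := (tensorAct X.ρ Y.ρ).comp (Bialgebra.comulAlgHom k H)

/-- The trivial representation `k`, on which `h` acts by `ε(h)`. -/
noncomputable def unit (k : Type u) (H : Type v) [Field k] [Ring H] [Bialgebra k H] :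
    HopfRep.{u, v} k H where
  V := k
  ρ := (Algebra.lmul k k).comp (Bialgebra.counitAlgHom k H)

/-- The tensor product of morphisms. -/
noncomputable def tensorMap {X X' Y Y' : HopfRep.{u, v} k H} (f : X ⟶ X') (g : Y ⟶ Y') :
    tensor X Y ⟶ tensor X' Y' :=
  homMk (TensorProduct.map (linearMap f) (linearMap g)) fun h =>
    tensorAct_map f.1 f.2 g.1 g.2 (Coalgebra.comul h)

/-- The associator is that of vector spaces. -/
noncomputable def associator (X Y Z : HopfRep.{u, v} k H) :
    tensor (tensor X Y) Z ≅ tensor X (tensor Y Z) :=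
  isoMk (TensorProduct.assoc k X.V Y.V Z.V) fun h => by
    change _ ∘ₗ tensorAct ((tensorAct X.ρ Y.ρ).comp (Bialgebra.comulAlgHom k H)) Z.ρ
        (Coalgebra.comul h) =
      tensorAct X.ρ ((tensorAct Y.ρ Z.ρ).comp (Bialgebra.comulAlgHom k H))
        (Coalgebra.comul h) ∘ₗ _
    rw [tensorAct_comp_left, tensorAct_comp_right]
    have := tensorAct_assoc X.ρ Y.ρ Z.ρ
      ((Coalgebra.comul (R := k)).rTensor H (Coalgebra.comul h))
    rw [Coalgebra.coassoc_apply] at this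
    exact this

/-- The left unitor is that of vector spaces. -/
noncomputable def leftUnitor (X : HopfRep.{u, v} k H) : tensor (unit k H) X ≅ X :=
  isoMk (TensorProduct.lid k X.V) fun h => by
    have := tensorAct_lid (Bialgebra.counitAlgHom k H) X.ρ (Coalgebra.comul h)
    erw [Coalgebra.rTensor_counit_comul] at this
    rw [TensorProduct.lid_tmul, one_smul] at this
    exact this

/-- The right unitor is that of vector spaces. -/
noncomputable def rightUnitor (X : HopfRep.{u, v} k H) : tensor X (unit k H) ≅ X :=
  isoMk (TensorProduct.rid k X.V) fun h => by
    have := tensorAct_rid (Bialgebra.counitAlgHom k H) X.ρ (Coalgebra.comul h)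
    erw [Coalgebra.lTensor_counit_comul] at this
    rw [TensorProduct.rid_tmul, one_smul] at this
    exact this

noncomputable instance : MonoidalCategoryStruct (HopfRep.{u, v} k H) where
  tensorObj := tensor
  whiskerLeft X _ _ f := tensorMap (𝟙 X) f
  whiskerRight f Y := tensorMap f (𝟙 Y)
  tensorHom := tensorMap
  tensorUnit := unit k H
  associator := associator
  leftUnitor := leftUnitor
  rightUnitor := rightUnitor

noncomputable instance : MonoidalCategory (HopfRep.{u, v} k H) where
  tensorHom_def _ _ := hom_ext (TensorProduct.ext' fun _ _ => rfl)
  id_tensorHom_id _ _ := hom_ext (TensorProduct.ext' fun _ _ => rfl)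
  tensorHom_comp_tensorHom _ _ _ _ := hom_ext (TensorProduct.ext' fun _ _ => rfl)
  whiskerLeft_id _ _ := hom_ext (TensorProduct.ext' fun _ _ => rfl)
  id_whiskerRight _ _ := hom_ext (TensorProduct.ext' fun _ _ => rfl)
  associator_naturality _ _ _ := hom_ext (TensorProduct.ext_threefold fun _ _ _ => rfl)
  leftUnitor_naturality f := hom_ext (TensorProduct.ext' fun (c : k) x =>
    ((linearMap f).map_smul c x).symm)
  rightUnitor_naturality f := hom_ext (TensorProduct.ext' fun x (c : k) =>
    ((linearMap f).map_smul c x).symm)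
  pentagon _ _ _ _ := hom_ext (TensorProduct.ext_fourfold fun _ _ _ _ => rfl)
  triangle _ _ := hom_ext (TensorProduct.ext_threefold fun x (c : k) y =>
    (TensorProduct.smul_tmul c x y).symm)

end Tensor

section Dual

variable {k : Type u} {H : Type v} [Field k] [Ring H] [HopfAlgebra k H]

/-- The dual representation `X*`, with `(h • f)(v) = f(S(h) v)`. -/
noncomputable def dual (X : HopfRep.{u, v} k H) : HopfRep.{u, v} k H where
  V := Module.Dual k X.V
  ρ := dualAct X.ρ

/-- The evaluation `X* ⊗ X ⟶ 1`. -/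
noncomputable def ev (X : HopfRep.{u, v} k H) : tensor X.dual X ⟶ unit k H :=
  homMk (contractLeft k X.V) fun h => TensorProduct.ext' fun f x => by
    refine (contractLeft_tensorAct X.ρ (Coalgebra.comul h) f x).trans ?_
    rw [HopfAlgebra.mul_antipode_rTensor_comul_apply]
    rw [AlgHom.commutes, Module.algebraMap_end_apply]
    exact LinearMap.map_smul (M₂ := k) f _ x

/-- The coevaluation `1 ⟶ X ⊗ X*`. -/
noncomputable def coev (X : HopfRep.{u, v} k H) : unit k H ⟶ tensor X X.dual :=
  homMk (coevaluation k X.V) fun h => LinearMap.ext_ring <| by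
    refine Eq.trans ?_ (tensorAct_coevaluation X.ρ (Coalgebra.comul h)).symm
    rw [HopfAlgebra.mul_antipode_lTensor_comul_apply, AlgHom.commutes, Algebra.algebraMap_eq_smul_one,
      TensorProduct.map_smul_left]
    erw [TensorProduct.map_id]
    change coevaluation k X.V (Coalgebra.counit (R := k) h * 1) = _
    rw [← smul_eq_mul, map_smul]
    rfl

noncomputable instance (X : HopfRep.{u, v} k H) : ExactPairing X X.dual where
  coevaluation' := coev X
  evaluation' := ev X
  coevaluation_evaluation' := hom_ext (contractLeft_assoc_coevaluation k X.V)
  evaluation_coevaluation' := hom_ext (contractLeft_assoc_coevaluation' k X.V)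

noncomputable instance (X : HopfRep.{u, v} k H) : HasRightDual X := ⟨X.dual⟩

noncomputable instance : RightRigidCategory (HopfRep.{u, v} k H) where

end Dual

section Restriction

variable {k : Type u} {A : Type v} {B : Type w} [Field k] [Ring A] [Bialgebra k A] [Ring B]
  [Bialgebra k B]

/-- Restriction of representations along a homomorphism of bialgebras `A → B`. -/
def res (f : A →ₐc[k] B) : HopfRep.{u, w} k B ⥤ HopfRep.{u, v} k A where
  obj X := { V := X.V, ρ := X.ρ.comp (f : A →ₐ[k] B) }
  map {X Y} g := homMk (linearMap (X := X) (Y := Y) g) fun a => g.2 (f a)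

theorem tensorAct_res (f : A →ₐc[k] B) (X Y : HopfRep.{u, w} k B) (a : A) :
    tensorAct (X.ρ.comp (f : A →ₐ[k] B)) (Y.ρ.comp (f : A →ₐ[k] B)) (Coalgebra.comul a) =
      tensorAct X.ρ Y.ρ (Coalgebra.comul (R := k) (f a)) := by
  rw [tensorAct_comp_left, tensorAct_comp_right, ← CoalgHomClass.map_comp_comul_apply]
  generalize Coalgebra.comul (R := k) a = t
  induction t with
  | zero => simp
  | add s t hs ht => simp only [map_add, hs, ht]
  | tmul a b => rfl

/-- Restriction is a tensor functor, whose structure isomorphisms are identity maps of the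
underlying vector spaces. -/
noncomputable instance (f : A →ₐc[k] B) : (res.{u, v, w} f).Monoidal :=
  Functor.CoreMonoidal.toMonoidal
    { εIso := isoMk (LinearEquiv.refl k k) fun a => by
        apply LinearMap.ext_ring
        change Coalgebra.counit (R := k) a * 1 = Coalgebra.counit (R := k) (f a) * 1
        rw [CoalgHomClass.counit_comp_apply]
      μIso := fun X Y => isoMk (LinearEquiv.refl k (X.V ⊗[k] Y.V)) fun a =>
        tensorAct_res f X Y a
      μIso_hom_natural_left := fun _ _ => hom_ext (TensorProduct.ext' fun _ _ => rfl)
      μIso_hom_natural_right := fun _ _ => hom_ext (TensorProduct.ext' fun _ _ => rfl)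
      associativity := fun _ _ _ => hom_ext (TensorProduct.ext_threefold fun _ _ _ => rfl)
      left_unitality := fun _ => hom_ext (TensorProduct.ext' fun _ _ => rfl)
      right_unitality := fun X => hom_ext (TensorProduct.ext' fun (x : X.V) (c : k) => by
        change c • x = c • x
        rfl) }

end Restriction
end HopfRep

/-! ### Functions on a finite group, Hopf subalgebras -/

/-- The Hopf algebra `Fun(G)` of `k`-valued functions on a finite group `G`: pointwise algebra
operations, `(Δ f)(x, y) = f(xy)`, `ε(f) = f(1)`, `(S f)(x) = f(x⁻¹)`. -/
def FunHopf (k G : Type*) := G → k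

namespace FunHopf

variable {k G : Type*} [Field k]

instance : CommRing (FunHopf k G) := inferInstanceAs (CommRing (G → k))
instance : Algebra k (FunHopf k G) := inferInstanceAs (Algebra k (G → k))

open Classical in
/-- The function `δ_x`, equal to `1` at `x` and to `0` elsewhere. -/
noncomputable def delta (k : Type*) {G : Type*} [Field k] (x : G) : FunHopf k G :=
  fun y => if y = x then 1 else 0

open Classical in
theorem delta_apply (x y : G) : delta k x y = if y = x then 1 else 0 := rfl

theorem mul_delta (f : FunHopf k G) (x : G) : f * delta k x = f x • delta k x := by
  classical
  funext y
  change f y * delta k x y = f x * delta k x y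
  rw [delta_apply]
  split_ifs with h
  · rw [h]
  · simp

theorem delta_mul_delta (x z : G) [Decidable (z = x)] :
    delta k x * delta k z = if z = x then delta k x else 0 := by
  rw [mul_delta]
  by_cases h : z = x
  · subst h; simp [delta]
  · simp [delta, h]

section Finite

variable [Fintype G]

theorem sum_delta (f : FunHopf k G) : ∑ x : G, f x • delta k x = f := by
  classical
  funext y
  have : (∑ x : G, f x • delta k x) y = ∑ x : G, f x * delta k x y :=
    Finset.sum_apply (M := fun _ : G => k) y Finset.univ _
  rw [this, Finset.sum_eq_single y]
  · simp [delta_apply]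
  · intro x _ hx
    simp [delta_apply, hx.symm]
  · simp

theorem one_eq_sum_delta : (1 : FunHopf k G) = ∑ x : G, delta k x := by
  rw [← sum_delta (1 : FunHopf k G)]
  exact Finset.sum_congr rfl fun x _ => one_smul k _

theorem linearMap_ext {M : Type*} [AddCommGroup M] [Module k M] {p q : FunHopf k G →ₗ[k] M}
    (h : ∀ x, p (delta k x) = q (delta k x)) : p = q := by
  ext f
  rw [← sum_delta f, map_sum, map_sum]
  exact Finset.sum_congr rfl fun x _ => by rw [map_smul, map_smul, h]

end Finite

section Antipode

variable [Group G]

/-- The antipode `(S f)(x) = f(x⁻¹)`. -/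
def antipodeMap : FunHopf k G →ₗ[k] FunHopf k G where
  toFun f := fun x => f x⁻¹
  map_add' _ _ := rfl
  map_smul' _ _ := rfl

theorem antipodeMap_delta (g : G) : antipodeMap (delta k g) = delta k g⁻¹ := by
  classical
  funext x
  change delta k g x⁻¹ = delta k g⁻¹ x
  simp only [delta_apply, inv_eq_iff_eq_inv]

end Antipode

section Hopf

variable [Group G] [Finite G]

/-- Comultiplication: `(Δ f)(x, y) = f(xy)`, that is,
`Δ f = ∑_{x, y} f(xy) δ_x ⊗ δ_y`. -/
noncomputable def comulMap : FunHopf k G →ₗ[k] FunHopf k G ⊗[k] FunHopf k G :=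
  letI := Fintype.ofFinite G
  { toFun f := ∑ x : G, ∑ y : G, f (x * y) • (delta k x ⊗ₜ[k] delta k y)
    map_add' f g := by
      simp only [← Finset.sum_add_distrib, ← add_smul]
      rfl
    map_smul' c f := by
      simp only [Finset.smul_sum, smul_smul]
      rfl }

theorem comulMap_apply [Fintype G] (f : FunHopf k G) :
    comulMap f = ∑ x : G, ∑ y : G, f (x * y) • (delta k x ⊗ₜ[k] delta k y) := by
  have : ‹Fintype G› = Fintype.ofFinite G := Subsingleton.elim _ _
  subst this
  rfl

theorem comulMap_delta [Fintype G] (g : G) :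
    comulMap (delta k g) = ∑ x : G, delta k x ⊗ₜ[k] delta k (x⁻¹ * g) := by
  classical
  rw [comulMap_apply]
  refine Finset.sum_congr rfl fun x _ => ?_
  rw [Finset.sum_eq_single (x⁻¹ * g)]
  · simp [delta]
  · intro y _ hy
    have : x * y ≠ g := fun h => hy (by rw [← h]; group)
    simp [delta, this]
  · simp

/-- Counit: evaluation at the identity. -/
def counitMap : FunHopf k G →ₗ[k] k where
  toFun f := f 1
  map_add' _ _ := rfl
  map_smul' _ _ := rfl

noncomputable instance : CoalgebraStruct k (FunHopf k G) where
  comul := comulMap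
  counit := counitMap

theorem comul_delta [Fintype G] (g : G) : Coalgebra.comul (R := k) (delta k g) = 
    ∑ x : G, delta k x ⊗ₜ[k] delta k (x⁻¹ * g) := comulMap_delta g

open Classical in
theorem counit_delta (g : G) : Coalgebra.counit (R := k) (delta k g) =
    if 1 = g then 1 else 0 := rfl

noncomputable instance : Coalgebra k (FunHopf k G) where
  coassoc := by
    let := Fintype.ofFinite G
    refine linearMap_ext fun g => ?_
    simp only [LinearMap.comp_apply, comul_delta, map_sum, LinearMap.rTensor_tmul,
      LinearMap.lTensor_tmul, LinearEquiv.coe_coe, TensorProduct.sum_tmul, TensorProduct.tmul_sum,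
      TensorProduct.assoc_tmul]
    rw [Finset.sum_comm]
    refine Finset.sum_congr rfl fun x _ => ?_
    refine Fintype.sum_equiv (Equiv.mulLeft x⁻¹) _ _ fun y => ?_
    simp [mul_assoc]
  rTensor_counit_comp_comul := by
    let := Fintype.ofFinite G
    refine linearMap_ext fun g => ?_
    simp only [LinearMap.comp_apply, comul_delta, map_sum, LinearMap.rTensor_tmul, counit_delta]
    rw [Finset.sum_eq_single 1]
    · simp
    · intro x _ hx
      simp [hx.symm]
    · simp
  lTensor_counit_comp_comul := by
    let := Fintype.ofFinite G
    refine linearMap_ext fun g => ?_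
    simp only [LinearMap.comp_apply, comul_delta, map_sum, LinearMap.lTensor_tmul, counit_delta]
    rw [Finset.sum_eq_single g]
    · simp
    · intro x _ hx
      have : (1 : G) ≠ x⁻¹ * g := fun h => hx (by rw [eq_inv_mul_iff_mul_eq] at h; simpa using h)
      simp [this]
    · simp

theorem comulMap_mul_delta (f : FunHopf k G) (x y : G) :
    comulMap f * (delta k x ⊗ₜ[k] delta k y) = f (x * y) • (delta k x ⊗ₜ[k] delta k y) := by
  classical
  let := Fintype.ofFinite G
  rw [comulMap_apply, Finset.sum_mul, Finset.sum_eq_single x, Finset.sum_mul,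
    Finset.sum_eq_single y]
  · simp [delta_mul_delta]
  · intro b _ hb
    simp [delta_mul_delta, hb.symm]
  · simp
  · intro a _ ha
    rw [Finset.sum_mul]
    refine Finset.sum_eq_zero fun b _ => ?_
    simp [delta_mul_delta, ha.symm]
  · simp

noncomputable instance : Bialgebra k (FunHopf k G) :=
  Bialgebra.mk' k (FunHopf k G) rfl (fun {_ _} => rfl)
    (by
      let := Fintype.ofFinite G
      change comulMap 1 = _
      rw [comulMap_apply, Algebra.TensorProduct.one_def, one_eq_sum_delta]
      simp only [TensorProduct.sum_tmul, TensorProduct.tmul_sum]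
      rw [Finset.sum_comm]
      refine Finset.sum_congr rfl fun x _ => Finset.sum_congr rfl fun y _ => ?_
      rw [← one_eq_sum_delta]
      exact one_smul k _)
    (fun {f g} => by
      let := Fintype.ofFinite G
      change comulMap (f * g) = comulMap f * comulMap g
      rw [comulMap_apply g, Finset.mul_sum, comulMap_apply]
      refine Finset.sum_congr rfl fun x _ => ?_
      rw [Finset.mul_sum]
      refine Finset.sum_congr rfl fun y _ => ?_
      rw [mul_smul_comm, comulMap_mul_delta, smul_smul, mul_comm (g (x * y))]
      rfl)

noncomputable instance : HopfAlgebra k (FunHopf k G) where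
  antipode := antipodeMap
  mul_antipode_rTensor_comul := by
    classical
    let := Fintype.ofFinite G
    refine linearMap_ext fun g => ?_
    rw [LinearMap.comp_apply, LinearMap.comp_apply, LinearMap.comp_apply, comul_delta,
      counit_delta]
    simp only [map_sum, LinearMap.rTensor_tmul, LinearMap.mul'_apply, antipodeMap_delta,
      delta_mul_delta]
    by_cases hg : 1 = g
    · subst hg
      simp only [mul_one, if_true, map_one, Algebra.linearMap_apply, one_eq_sum_delta]
      exact Fintype.sum_equiv (Equiv.inv G) _ _ fun _ => rfl
    · simp [hg, Ne.symm hg]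
  mul_antipode_lTensor_comul := by
    classical
    let := Fintype.ofFinite G
    refine linearMap_ext fun g => ?_
    rw [LinearMap.comp_apply, LinearMap.comp_apply, LinearMap.comp_apply, comul_delta,
      counit_delta]
    simp only [map_sum, LinearMap.lTensor_tmul, LinearMap.mul'_apply, antipodeMap_delta,
      delta_mul_delta]
    by_cases hg : 1 = g
    · subst hg
      simp [one_eq_sum_delta]
    · simp [hg, Ne.symm hg]

end Hopf
end FunHopf

section HopfSubalgebra

variable (k : Type u) (H : Type v) [Field k] [Ring H] [HopfAlgebra k H]

/-- A Hopf subalgebra of `H`: a subalgebra `K` with `Δ(K) ⊆ K ⊗ K` and `S(K) ⊆ K`. -/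
structure HopfSubalgebra extends Subalgebra k H where
  comul_mem : ∀ x ∈ carrier, Coalgebra.comul (R := k) x ∈
    LinearMap.range (TensorProduct.map toSubalgebra.val.toLinearMap toSubalgebra.val.toLinearMap)
  antipode_mem : ∀ x ∈ carrier, HopfAlgebra.antipode k x ∈ carrier

namespace HopfSubalgebra

variable {k H}

instance : SetLike (HopfSubalgebra k H) H where
  coe K := K.carrier
  coe_injective K L h := by
    cases K
    cases L
    congr
    exact SetLike.coe_injective h

instance : PartialOrder (HopfSubalgebra k H) := .ofSetLike (HopfSubalgebra k H) H

/-- `K` is contained in the center of `H`. -/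
def IsCentral (K : HopfSubalgebra k H) : Prop := ∀ x ∈ K, ∀ h : H, h * x = x * h

/-- The left ideal `HK⁺` generated by `K⁺ = K ∩ ker ε`. -/
def augIdeal (K : HopfSubalgebra k H) : Ideal H :=
  Ideal.span {x | x ∈ K ∧ Coalgebra.counit (R := k) x = 0}

end HopfSubalgebra

end HopfSubalgebra

/-!
Every representation of `H` is semisimple, and `H` is finite-dimensional
(`finite_of_isSemisimpleRing`): the right tensor legs of `Δ Λ`, for an integral `Λ` with `ε(Λ) =
1`, form a finite-dimensional left ideal that contains `∑ S(Λ₁) Λ₂ = 1`. The same integral shows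
that the antipode is bijective, so that duals of simple representations are simple.

The classes of simple representations, with "`l` is a constituent of `i ⊗ j`" as a multivalued
product, form a polygroup (`HopfRep.simplePolygroup`). In a polygroup, let the adjoint part be
generated by the values of the products `i i*`. A value of `i (j j*)` is a value of `(m m*) i` for
some value `m` of `i j`; hence the adjoint part is normal (`Polygroup.Adjoint.normal`), and the
quotient by it is a group (`Polygroup.GradingGroup`) with a degree map that is multiplicative.

The polygroup is related to the Grothendieck ring by characters. By Jacobson density an element of
`H` can be found that acts by prescribed scalars on the simple representations
(`HopfRep.exists_ρ_eq_smul`), and in characteristic `0` traces detect whether an idempotent of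
this kind vanishes on a representation. So the classes of the simple representations are linearly
independent, and the class of `Y` lies in the span of a set of basic elements exactly when all
constituents of `Y` belong to this set (`HopfRep.objClass_mem_classSpan_iff`). It follows that
`R_ad` is the span of the adjoint part and that the indecomposable based subbimodules are the
spans of the fibres of the degree map (`HopfRep.isIndecomposableSubbimodule_iff`), which
identifies `U(Rep H)` with the grading group of the polygroup.

A function `f` on `U(Rep H)` defines the element of `H` that acts by `f(a)` on the simple
representations of degree `a`. As `H` acts faithfully on the sum of the simple representations,
and `H ⊗ H` on the sum of their tensor products, this gives an injective homomorphism of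
bialgebras (`HopfRep.gradingHom`) with central image. If `K` is any central Hopf subalgebra, then
`x ∈ K` acts by a scalar on each simple representation, `K` acts through `ε` on `X ⊗ X*` for
simple `X` and hence on the adjoint part; so the scalar depends on the degree only, and `x` is in
the image of `Fun(U(Rep H))` (`HopfRep.le_gradingSubalgebra`). The image is therefore the largest
central Hopf subalgebra. The representations of `H / HK⁺` are those on which `K` acts through `ε`;
if `K` is the image of `Fun(U(Rep H))`, these are the sums of simple representations of degree
`1`, that is, `C_ad` (`HopfRep.isTrivialOn_gradingSubalgebra`).
-/

/-! ### Representations as modules -/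

namespace HopfRep

section Modules

variable {k : Type u} {H : Type v} [Field k] [Ring H] [Algebra k H]

/-- A representation of `H` is an `H`-module. -/
instance moduleOfRep (X : HopfRep.{u, v} k H) : Module H X.V :=
  Module.compHom X.V (X.ρ : H →+* Module.End k X.V)

theorem smul_eq (X : HopfRep.{u, v} k H) (h : H) (x : X.V) : h • x = X.ρ h x := rfl

instance (X : HopfRep.{u, v} k H) : IsScalarTower k H X.V where
  smul_assoc c h x := by simp [smul_eq]

instance (X : HopfRep.{u, v} k H) : SMulCommClass k H X.V where
  smul_comm c h x := by simp [smul_eq]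

instance (X : HopfRep.{u, v} k H) : SMulCommClass H k X.V := .symm _ _ _

/-- The representation given by an `H`-module that is finite-dimensional over `k`. -/
noncomputable def ofModule (V : Type u) [AddCommGroup V] [Module k V] [Module H V]
    [IsScalarTower k H V] [Module.Finite k V] : HopfRep.{u, v} k H where
  V := V
  ρ := Algebra.lsmul k k V

/-- A morphism of representations as an `H`-linear map. -/
def toLin {X Y : HopfRep.{u, v} k H} (f : X ⟶ Y) : X.V →ₗ[H] Y.V where
  toFun := linearMap f
  map_add' := (linearMap f).map_add
  map_smul' := linearMap_comm f

/-- An `H`-linear map as a morphism of representations. -/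
def ofLin {X Y : HopfRep.{u, v} k H} (f : X.V →ₗ[H] Y.V) : X ⟶ Y :=
  homMk (f.restrictScalars k) fun h => LinearMap.ext fun x => f.map_smul h x

@[simp] theorem toLin_ofLin {X Y : HopfRep.{u, v} k H} (f : X.V →ₗ[H] Y.V) :
    toLin (ofLin f) = f := rfl

@[simp] theorem ofLin_toLin {X Y : HopfRep.{u, v} k H} (f : X ⟶ Y) : ofLin (toLin f) = f := rfl

theorem toLin_injective {X Y : HopfRep.{u, v} k H} :
    Function.Injective (toLin (X := X) (Y := Y)) := fun f g h => by
  rw [← ofLin_toLin f, h, ofLin_toLin]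

@[simp] theorem toLin_comp {X Y Z : HopfRep.{u, v} k H} (f : X ⟶ Y) (g : Y ⟶ Z) :
    toLin (f ≫ g) = (toLin g).comp (toLin f) := rfl

@[simp] theorem toLin_id (X : HopfRep.{u, v} k H) : toLin (𝟙 X) = LinearMap.id := rfl

@[simp] theorem toLin_zero {X Y : HopfRep.{u, v} k H} : toLin (0 : X ⟶ Y) = 0 := rfl

theorem toLin_eq_zero {X Y : HopfRep.{u, v} k H} {f : X ⟶ Y} : toLin f = 0 ↔ f = 0 :=
  ⟨fun h => toLin_injective h, fun h => by rw [h, toLin_zero]⟩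

/-- Isomorphisms of representations are `H`-linear equivalences. -/
def isoOfLinearEquiv {X Y : HopfRep.{u, v} k H} (e : X.V ≃ₗ[H] Y.V) : X ≅ Y where
  hom := ofLin e.toLinearMap
  inv := ofLin e.symm.toLinearMap
  hom_inv_id := toLin_injective (LinearMap.ext fun x => e.symm_apply_apply x)
  inv_hom_id := toLin_injective (LinearMap.ext fun x => e.apply_symm_apply x)

/-- The linear equivalence underlying an isomorphism of representations. -/
def linearEquivOfIso {X Y : HopfRep.{u, v} k H} (e : X ≅ Y) : X.V ≃ₗ[H] Y.V :=
  LinearEquiv.ofLinearMap (toLin e.hom) (toLin e.inv)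
    (by rw [← toLin_comp, e.inv_hom_id, toLin_id]) (by rw [← toLin_comp, e.hom_inv_id, toLin_id])

/-- A subrepresentation, given by an `H`-submodule. -/
noncomputable def ofSubmodule (X : HopfRep.{u, v} k H) (N : Submodule H X.V) :
    HopfRep.{u, v} k H :=
  haveI : Module.Finite k N := Module.Finite.of_injective (N.subtype.restrictScalars k)
    Subtype.val_injective
  ofModule N

/-- The inclusion of a subrepresentation. -/
noncomputable def incl (X : HopfRep.{u, v} k H) (N : Submodule H X.V) : ofSubmodule X N ⟶ X :=
  ofLin (X := ofSubmodule X N)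
    { toFun := fun x : N => (x : X.V), map_add' := fun _ _ => rfl, map_smul' := fun _ _ => rfl }

theorem incl_injective (X : HopfRep.{u, v} k H) (N : Submodule H X.V) :
    Function.Injective (toLin (incl X N)) := Subtype.val_injective

theorem mono_of_injective {X Y : HopfRep.{u, v} k H} (f : X ⟶ Y)
    (hf : Function.Injective (toLin f)) : Mono f where
  right_cancellation g h e := toLin_injective <| LinearMap.ext fun x => hf <| by
    have := congrArg toLin e
    exact LinearMap.congr_fun this x

theorem injective_of_mono {X Y : HopfRep.{u, v} k H} (f : X ⟶ Y) [Mono f] :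
    Function.Injective (toLin f) := by
  rw [← LinearMap.ker_eq_bot, Submodule.eq_bot_iff]
  intro x hx
  have h : incl X (LinearMap.ker (toLin f)) ≫ f = 0 ≫ f :=
    toLin_injective (LinearMap.ext fun y =>
      (LinearMap.mem_ker.1 (Subtype.prop (show LinearMap.ker (toLin f) from y))).trans
        (toLin f).map_zero.symm)
  have h' := congrArg toLin ((cancel_mono f).1 h)
  exact LinearMap.congr_fun h' (⟨x, hx⟩ : LinearMap.ker (toLin f))

theorem isIso_of_bijective {X Y : HopfRep.{u, v} k H} (f : X ⟶ Y)
    (hf : Function.Bijective (toLin f)) : IsIso f :=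
  (isoOfLinearEquiv (LinearEquiv.ofBijective (toLin f) hf)).isIso_hom

theorem bijective_of_isIso {X Y : HopfRep.{u, v} k H} (f : X ⟶ Y) [IsIso f] :
    Function.Bijective (toLin f) := (linearEquivOfIso (asIso f)).bijective

theorem simple_iff (X : HopfRep.{u, v} k H) : Simple X ↔ IsSimpleModule H X.V := by
  constructor
  · intro hX
    have hid : (𝟙 X) ≠ 0 := id_nonzero X
    have : Nontrivial X.V := by
      by_contra h
      rw [not_nontrivial_iff_subsingleton] at h
      exact hid (toLin_injective (LinearMap.ext fun x => Subsingleton.elim _ _))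
    refine { eq_bot_or_eq_top := fun N => ?_ }
    have := mono_of_injective _ (incl_injective X N)
    by_cases h : incl X N = 0
    · left
      rw [Submodule.eq_bot_iff]
      intro x hx
      exact LinearMap.congr_fun (congrArg toLin h) (⟨x, hx⟩ : N)
    · right
      have := isIso_of_mono_of_nonzero h
      rw [eq_top_iff]
      intro x _
      obtain ⟨y, rfl⟩ := (bijective_of_isIso (incl X N)).2 x
      exact Subtype.prop (show N from y)
  · intro hX
    refine ⟨fun f => ⟨fun hf h => ?_, fun h => ?_⟩⟩
    · have := IsSimpleModule.nontrivial H X.V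
      obtain ⟨x, hx⟩ := exists_ne (0 : X.V)
      obtain ⟨y, rfl⟩ := (bijective_of_isIso f).2 x
      rw [h] at hx
      exact hx rfl
    · apply isIso_of_bijective
      refine ⟨injective_of_mono f, ?_⟩
      exact LinearMap.surjective_of_ne_zero fun h' => h (toLin_eq_zero.1 h')

/-- Complementary subrepresentations give a direct sum decomposition. -/
theorem isDirectSum_of_isCompl (X : HopfRep.{u, v} k H) {N N' : Submodule H X.V}
    (h : IsCompl N N') : IsDirectSum X (ofSubmodule X N) (ofSubmodule X N') := by
  refine ⟨incl X N, incl X N', ofLin (Y := ofSubmodule X N) (N.projectionOnto N' h),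
    ofLin (Y := ofSubmodule X N') (N'.projectionOnto N h.symm), ?_, ?_, ?_, ?_, ?_⟩
  all_goals apply toLin_injective; apply LinearMap.ext; intro x
  · exact Submodule.projectionOnto_apply_left h x
  · exact Submodule.projectionOnto_apply_left h.symm x
  · exact Submodule.projectionOnto_apply_right h.symm x
  · exact Submodule.projectionOnto_apply_right h x
  · exact Submodule.projection_add_projection_eq_self h x

/-- Every representation of a semisimple algebra is a finite direct sum of simple ones: the
corresponding induction principle. -/
theorem induction_simple [IsSemisimpleRing H] {P : HopfRep.{u, v} k H → Prop}
    (zero : ∀ X : HopfRep.{u, v} k H, Subsingleton X.V → P X)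
    (simple : ∀ X : HopfRep.{u, v} k H, Simple X → P X)
    (directSum : ∀ Z X Y : HopfRep.{u, v} k H, IsDirectSum Z X Y → P X → P Y → P Z)
    (X : HopfRep.{u, v} k H) : P X := by
  induction hn : Module.finrank k X.V using Nat.strong_induction_on generalizing X with
  | _ n ih =>
    by_cases hX : Subsingleton X.V
    · exact zero X hX
    by_cases hs : IsSimpleModule H X.V
    · exact simple X ((simple_iff X).2 hs)
    rw [not_subsingleton_iff_nontrivial] at hX
    obtain ⟨N, hN⟩ := IsSemisimpleModule.exists_simple_submodule (R := H) (M := X.V)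
    obtain ⟨N', hc⟩ := exists_isCompl N
    have hNtop : N ≠ ⊤ := by
      rintro rfl
      exact hs (IsSimpleModule.congr (Submodule.topEquiv (R := H) (M := X.V)).symm)
    have hNbot : N ≠ ⊥ := (isSimpleModule_iff_isAtom.1 hN).1
    have hNtop' : N' ≠ ⊤ := fun h => hNbot (by simpa [h] using hc.inf_eq_bot)
    have lt : ∀ M : Submodule H X.V, M ≠ ⊤ → Module.finrank k (ofSubmodule X M).V < n := by
      intro M hM
      rw [← hn]
      refine Submodule.finrank_lt (K := k) (s := M.restrictScalars k) fun h => hM ?_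
      rwa [Submodule.restrictScalars_eq_top_iff] at h
    exact directSum X _ _ (isDirectSum_of_isCompl X hc)
      (ih _ (lt N hNtop) _ rfl) (ih _ (lt N' hNtop') _ rfl)

end Modules

end HopfRep

/-! ### Finite-dimensionality and the antipode -/

section FiniteDimensional

variable (k : Type u) (H : Type v) [Field k] [Ring H] [HopfAlgebra k H]

open Coalgebra HopfAlgebra

/-- A semisimple Hopf algebra has a left integral `Λ` with `ε(Λ) = 1`: a complement of the left
ideal `ker ε` is spanned by it. -/
theorem exists_normalized_integral [IsSemisimpleRing H] :
    ∃ L : H, counit (R := k) L = 1 ∧ ∀ h : H, h * L = counit (R := k) h • L := by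
  let I : Ideal H := RingHom.ker (Bialgebra.counitAlgHom k H)
  obtain ⟨J, hJ⟩ := exists_isCompl I
  have h1 : (1 : H) ∈ I ⊔ J := by rw [hJ.sup_eq_top]; trivial
  obtain ⟨a, ha, L, hL, haL⟩ := Submodule.mem_sup.1 h1
  have ha' : counit (R := k) a = 0 := ha
  have hε : counit (R := k) L = 1 := by
    have := congrArg (counit (R := k)) haL
    rwa [map_add, ha', zero_add, Bialgebra.counit_one] at this
  refine ⟨L, hε, fun h => ?_⟩
  have hI : (h - algebraMap k H (counit (R := k) h)) * L ∈ I ⊓ J := by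
    refine ⟨?_, J.mul_mem_left _ hL⟩
    change Bialgebra.counitAlgHom k H _ = 0
    rw [map_mul, map_sub, AlgHom.commutes]
    simp
  rw [hJ.inf_eq_bot, Submodule.mem_bot, sub_mul, sub_eq_zero] at hI
  rw [hI, Algebra.smul_def]

variable {k H} in
/-- The invariance of `Δ Λ` for a left integral `Λ`: `(1 ⊗ h) Δ Λ = (S h ⊗ 1) Δ Λ`. -/
theorem one_tmul_mul_comul_integral {L : H} (hL : ∀ h : H, h * L = counit (R := k) h • L) (h : H) :
    (1 ⊗ₜ[k] h) * comul (R := k) L = (antipode k h ⊗ₜ[k] 1) * comul (R := k) L := by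
  -- Both sides are `∑ S(h₁) h₂ Λ₁ ⊗ h₃ Λ₂`.
  let Φ : H ⊗[k] (H ⊗[k] H) →ₗ[k] H ⊗[k] H :=
    TensorProduct.lift (LinearMap.mk₂ k
      (fun (a : H) (t : H ⊗[k] H) => (antipode k a ⊗ₜ[k] (1 : H)) * t * comul (R := k) L)
      (fun a b t => by simp [TensorProduct.add_tmul, add_mul])
      (fun c a t => by simp [← TensorProduct.smul_tmul'])
      (fun a s t => by simp [mul_add, add_mul])
      (fun c a t => by simp))
  have hΦ : ∀ a t, Φ (a ⊗ₜ t) = (antipode k a ⊗ₜ[k] (1 : H)) * t * comul (R := k) L :=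
    fun _ _ => rfl
  -- first evaluation: `h₂ Λ₁ ⊗ h₃ Λ₂ = ε(h₂) Λ₁ ⊗ Λ₂`
  have e1 : ∀ t : H ⊗[k] H, Φ ((comul (R := k)).lTensor H t) =
      (antipode k (TensorProduct.rid k H ((counit (R := k)).lTensor H t)) ⊗ₜ[k] 1) *
        comul (R := k) L := by
    intro t
    induction t with
    | zero => simp
    | add s t hs ht => simp only [map_add, hs, ht, TensorProduct.add_tmul, add_mul]
    | tmul a b =>
      rw [LinearMap.lTensor_tmul, hΦ, mul_assoc, ← Bialgebra.comul_mul, hL]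
      simp [← TensorProduct.smul_tmul']
  -- second evaluation: `S(h₁) h₂ ⊗ h₃ = 1 ⊗ h`
  have e2 : ∀ t : (H ⊗[k] H) ⊗[k] H, Φ (TensorProduct.assoc k H H H t) =
      ((LinearMap.mul' k H ∘ₗ (antipode k).rTensor H).rTensor H t) * comul (R := k) L := by
    intro t
    induction t with
    | zero => simp
    | add s t hs ht => simp only [map_add, hs, ht, add_mul]
    | tmul a b =>
      induction a with
      | zero => simp
      | add s t hs ht => simp only [TensorProduct.add_tmul, map_add, hs, ht, add_mul]
      | tmul a c =>
        rw [TensorProduct.assoc_tmul, hΦ]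
        simp
  have h1 := e1 (comul (R := k) h)
  have h2 := e2 ((comul (R := k)).rTensor H (comul (R := k) h))
  rw [coassoc_apply] at h2
  rw [h1, lTensor_counit_comul] at h2
  rw [← LinearMap.comp_apply, ← LinearMap.rTensor_comp, LinearMap.comp_assoc,
    mul_antipode_rTensor_comul, LinearMap.rTensor_comp, LinearMap.comp_apply,
    rTensor_counit_comul] at h2
  simpa using h2.symm

variable {k H} in
/-- The contraction `a ⊗ b ↦ f(a) b` of the first tensor leg with a functional `f`. -/
noncomputable def contractFst : H ⊗[k] H →ₗ[k] Module.Dual k H →ₗ[k] H :=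
  TensorProduct.lift (LinearMap.mk₂ k
    (fun (a b : H) => LinearMap.toSpanSingleton k H b ∘ₗ Module.Dual.eval k H a)
    (fun a b c => by
      refine LinearMap.ext fun f => ?_
      change f (a + b) • c = f a • c + f b • c
      rw [map_add, add_smul])
    (fun c a b => by
      refine LinearMap.ext fun f => ?_
      change f (c • a) • b = c • f a • b
      rw [map_smul, smul_assoc])
    (fun a b c => LinearMap.ext fun f => smul_add (f a) b c)
    (fun c a b => LinearMap.ext fun f => smul_comm (f a) c b))

variable {k H} in
theorem contractFst_tmul (a b : H) (f : Module.Dual k H) :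
    contractFst (a ⊗ₜ[k] b) f = f a • b := rfl

variable {k H} in
theorem mul_contractFst (h : H) (t : H ⊗[k] H) (f : Module.Dual k H) :
    h * contractFst t f = contractFst ((1 ⊗ₜ[k] h) * t) f := by
  induction t with
  | zero => simp
  | add s t hs ht => simp only [map_add, LinearMap.add_apply, mul_add, hs, ht]
  | tmul a b => simp [contractFst_tmul]

/-- If `Λ` is an integral with `ε(Λ) = 1`, the right tensor legs `∑ f(Λ₁) Λ₂` of `Δ Λ` form a left
ideal. This ideal contains `∑ S(Λ₁) Λ₂ = 1`, so that all elements of `H` are of this form. -/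
theorem exists_contractFst_surjective [IsSemisimpleRing H] :
    ∃ L : H, (∀ h : H, h * L = counit (R := k) h • L) ∧
      Function.Surjective (contractFst (comul (R := k) L)) := by
  obtain ⟨L, hε, hL⟩ := exists_normalized_integral k H
  let W : Submodule k H := LinearMap.range (contractFst (comul (R := k) L))
  have hideal : ∀ h : H, ∀ w ∈ W, h * w ∈ W := by
    rintro h _ ⟨f, rfl⟩
    refine ⟨f ∘ₗ LinearMap.mulLeft k (antipode k h), ?_⟩
    have e2 : ∀ t : H ⊗[k] H, contractFst t (f ∘ₗ LinearMap.mulLeft k (antipode k h)) =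
        contractFst ((antipode k h ⊗ₜ[k] 1) * t) f := by
      intro t
      induction t with
      | zero => simp
      | add s t hs ht => simp only [map_add, LinearMap.add_apply, mul_add, hs, ht]
      | tmul a b => simp [contractFst_tmul]
    rw [mul_contractFst, e2, one_tmul_mul_comul_integral hL]
  have hrange : ∃ t : H ⊗[k] W, (W.subtype.lTensor H) t = comul (R := k) L := by
    -- expand `Δ Λ = ∑ aᵢ ⊗ bᵢ` along a basis `aᵢ` of `H`; then `bᵢ` is a contraction of `Δ Λ`
    let B := Module.Basis.ofVectorSpace k H
    have key : ∀ t : H ⊗[k] H, ∃ s : Finset (Module.Basis.ofVectorSpaceIndex k H), ∀ s', s ⊆ s' →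
        t = ∑ i ∈ s', B i ⊗ₜ[k] contractFst t (B.coord i) := by
      classical
      intro t
      induction t with
      | zero => exact ⟨∅, by simp⟩
      | add x y hx hy =>
        obtain ⟨s₁, h₁⟩ := hx
        obtain ⟨s₂, h₂⟩ := hy
        refine ⟨s₁ ∪ s₂, fun s' hs' => ?_⟩
        simp only [map_add, LinearMap.add_apply, TensorProduct.tmul_add, Finset.sum_add_distrib]
        rw [← h₁ s' (Finset.union_subset_left hs'), ← h₂ s' (Finset.union_subset_right hs')]
      | tmul a b =>
        refine ⟨(B.repr a).support, fun s' hs' => ?_⟩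
        simp only [contractFst_tmul, TensorProduct.tmul_smul, TensorProduct.smul_tmul',
          ← TensorProduct.sum_tmul]
        congr 1
        conv_lhs => rw [← B.linearCombination_repr a]
        rw [Finsupp.linearCombination_apply, Finsupp.sum_of_support_subset _ hs']
        · rfl
        · simp
    obtain ⟨s, hs⟩ := key (comul (R := k) L)
    refine ⟨∑ i ∈ s, B i ⊗ₜ[k] ⟨contractFst (comul (R := k) L) (B.coord i), ⟨_, rfl⟩⟩, ?_⟩
    rw [map_sum]
    exact (hs s subset_rfl).symm
  obtain ⟨t, ht⟩ := hrange
  have hone : (1 : H) ∈ W := by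
    have h1 := mul_antipode_rTensor_comul_apply (R := k) L
    rw [hε, map_one, ← ht] at h1
    rw [← h1]
    clear ht h1
    induction t with
    | zero => simp
    | add s t hs ht => simpa only [map_add] using W.add_mem hs ht
    | tmul a b =>
      simpa using hideal _ _ b.2
  exact ⟨L, hL, fun h => by
    have := hideal h 1 hone
    rwa [mul_one] at this⟩

/-- A semisimple Hopf algebra is finite-dimensional, as the right tensor legs of `Δ Λ` span a
finite-dimensional space. -/
theorem finite_of_isSemisimpleRing [IsSemisimpleRing H] : Module.Finite k H := by
  obtain ⟨L, -, hL⟩ := exists_contractFst_surjective k H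
  have key : ∀ t : H ⊗[k] H, ∃ F : Submodule k H, Module.Finite k F ∧
      LinearMap.range (contractFst t) ≤ F := by
    intro t
    induction t with
    | zero => exact ⟨⊥, inferInstance, by rw [map_zero, LinearMap.range_zero]⟩
    | add s t hs ht =>
      obtain ⟨F, hF, h1⟩ := hs
      obtain ⟨G, hG, h2⟩ := ht
      refine ⟨F ⊔ G, inferInstance, ?_⟩
      rintro _ ⟨f, rfl⟩
      rw [map_add]
      exact Submodule.add_mem_sup (h1 ⟨f, rfl⟩) (h2 ⟨f, rfl⟩)
    | tmul a b =>
      refine ⟨Submodule.span k {b}, inferInstance, ?_⟩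
      rintro _ ⟨f, rfl⟩
      rw [contractFst_tmul]
      exact Submodule.smul_mem _ _ (Submodule.mem_span_singleton_self b)
  obtain ⟨F, hF, hle⟩ := key (comul (R := k) L)
  rw [LinearMap.range_eq_top.2 hL, top_le_iff] at hle
  rw [hle] at hF
  exact Module.Finite.equiv (Submodule.topEquiv (R := k) (M := H))

/-- The antipode of a semisimple Hopf algebra is bijective: if `S(h) = 0` then
`(1 ⊗ h) Δ Λ = (S(h) ⊗ 1) Δ Λ = 0`, whence `h = 0`. -/
theorem antipode_bijective [IsSemisimpleRing H] : Function.Bijective (antipode k (A := H)) := by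
  have := finite_of_isSemisimpleRing k H
  have hinj : Function.Injective (antipode k (A := H)) := by
    obtain ⟨L, hL, hsurj⟩ := exists_contractFst_surjective k H
    rw [← LinearMap.ker_eq_bot, Submodule.eq_bot_iff]
    intro h hh
    obtain ⟨f, hf⟩ := hsurj 1
    rw [← mul_one h, ← hf, mul_contractFst, one_tmul_mul_comul_integral hL,
      LinearMap.mem_ker.1 hh, TensorProduct.zero_tmul, zero_mul, map_zero, LinearMap.zero_apply]
  exact ⟨hinj, LinearMap.injective_iff_surjective.1 hinj⟩

end FiniteDimensional

/-! ### Polygroups and their universal grading groups -/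

/-- A polygroup: a set with a multivalued associative multiplication, a unit and reversible
inverses. `prod i j l` means that `l` is one of the values of the product of `i` and `j`. The
basis of a based ring is a polygroup, `l` being a value of `i j` if the basic element `l` occurs
in `i j`. -/
structure Polygroup (J : Type*) where
  prod : J → J → J → Prop
  one : J
  star : J → J
  nonempty : ∀ i j, ∃ l, prod i j l
  assoc : ∀ i j l p, (∃ m, prod i j m ∧ prod m l p) ↔ ∃ m, prod j l m ∧ prod i m p
  one_prod : ∀ i j, prod one i j ↔ i = j
  prod_star : ∀ {i j l}, prod i j l → prod l (star j) i
  star_prod : ∀ {i j l}, prod i j l → prod (star i) l j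

namespace Polygroup

variable {J : Type*} (P : Polygroup J)

theorem one_prod_self (i : J) : P.prod P.one i i := (P.one_prod i i).2 rfl

theorem prod_star_self (i : J) : P.prod i (P.star i) P.one := P.prod_star (P.one_prod_self i)

theorem star_star (i : J) : P.star (P.star i) = i :=
  (P.one_prod _ _).1 (P.prod_star (P.prod_star_self i))

theorem star_one : P.star P.one = P.one :=
  (P.one_prod _ _).1 (P.prod_star_self P.one)

theorem star_prod_star {i j l : J} (h : P.prod i j l) :
    P.prod (P.star j) (P.star i) (P.star l) :=
  P.prod_star (P.star_prod (P.prod_star h))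

theorem prod_one {i j : J} : P.prod i P.one j ↔ i = j := by
  constructor
  · intro h
    have := P.star_prod_star h
    rw [star_one, one_prod] at this
    rw [← P.star_star i, this, P.star_star]
  · rintro rfl
    have := P.star_prod_star (P.one_prod_self (P.star i))
    rwa [star_one, star_star] at this

/-- The adjoint part: the smallest set that is closed under products and contains the unit and all
values of the products `i i*`. -/
inductive Adjoint : J → Prop
  | one : Adjoint P.one
  | pair {i l : J} : P.prod i (P.star i) l → Adjoint l
  | mul {a b l : J} : Adjoint a → Adjoint b → P.prod a b l → Adjoint l

variable {P}

theorem Adjoint.star {a : J} (ha : P.Adjoint a) : P.Adjoint (P.star a) := by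
  induction ha with
  | one => rw [star_one]; exact .one
  | pair h =>
    have := P.star_prod_star h
    rw [star_star] at this
    exact .pair this
  | mul _ _ h iha ihb => exact .mul ihb iha (P.star_prod_star h)

/-- The adjoint part is normal. On generators: a value of `i (j j*)` is a value of `m j*` for some
value `m` of `i j`, and `j*` is a value of `m* i`, so that one gets a value of `(m m*) i`. -/
theorem Adjoint.normal {a : J} (ha : P.Adjoint a) {i m : J} (h : P.prod i a m) :
    ∃ a', P.Adjoint a' ∧ P.prod a' i m := by
  induction ha generalizing i m with
  | one => exact ⟨P.one, .one, (P.one_prod _ _).2 (P.prod_one.1 h)⟩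
  | @pair j a hj =>
    obtain ⟨p, hp, hp'⟩ := (P.assoc _ _ _ _).2 ⟨a, hj, h⟩
    have h1 := P.star_prod_star (P.star_prod hp)
    rw [star_star] at h1
    obtain ⟨q, hq, hq'⟩ := (P.assoc _ _ _ _).2 ⟨_, h1, hp'⟩
    exact ⟨q, .pair hq, hq'⟩
  | @mul b c a _ _ hbc ihb ihc =>
    obtain ⟨p, hp, hp'⟩ := (P.assoc _ _ _ _).2 ⟨a, hbc, h⟩
    obtain ⟨b', hb', hb''⟩ := ihb hp
    obtain ⟨c', hc', hc''⟩ := ihc hp'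
    obtain ⟨q, hq, hq'⟩ := (P.assoc _ _ _ _).2 ⟨_, hb'', hc''⟩
    exact ⟨q, .mul hc' hb' hq, hq'⟩

variable (P)

/-- Two elements have the same degree if they differ by a factor from the adjoint part. -/
def degreeSetoid : Setoid J where
  r i j := ∃ a, P.Adjoint a ∧ P.prod a i j
  iseqv :=
    { refl := fun i => ⟨P.one, .one, P.one_prod_self i⟩
      symm := fun ⟨a, ha, h⟩ => ⟨P.star a, ha.star, P.star_prod h⟩
      trans := fun {i j l} ⟨a, ha, h⟩ ⟨b, hb, h'⟩ => by
        obtain ⟨q, hq, hq'⟩ := (P.assoc _ _ _ _).2 ⟨_, h, h'⟩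
        exact ⟨q, .mul hb ha hq, hq'⟩ }

theorem degreeSetoid_of_prod {i j l l' : J} (h : P.prod i j l) (h' : P.prod i j l') :
    P.degreeSetoid l l' := by
  obtain ⟨q, hq, hq'⟩ := (P.assoc _ _ _ _).2 ⟨_, P.star_prod h, h'⟩
  exact ⟨q, .pair hq, hq'⟩

theorem degreeSetoid_prod {i i' j j' l l' : J} (hi : P.degreeSetoid i i')
    (hj : P.degreeSetoid j j') (h : P.prod i j l) (h' : P.prod i' j' l') :
    P.degreeSetoid l l' := by
  obtain ⟨a, ha, hai⟩ := hi
  obtain ⟨b, hb, hbj⟩ := hj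
  obtain ⟨l₁, h₁, hl₁⟩ := (P.assoc _ _ _ _).1 ⟨_, hai, h'⟩
  obtain ⟨p, hp, hp'⟩ := (P.assoc _ _ _ _).2 ⟨_, hbj, h₁⟩
  obtain ⟨b', hb', hb''⟩ := hb.normal hp
  obtain ⟨l₂, h₂, hl₂⟩ := (P.assoc _ _ _ _).1 ⟨_, hb'', hp'⟩
  exact P.degreeSetoid.trans (P.degreeSetoid_of_prod h h₂)
    (P.degreeSetoid.trans ⟨b', hb', hl₂⟩ ⟨a, ha, hl₁⟩)

/-- The universal grading group of a polygroup: its quotient by the adjoint part. -/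
def GradingGroup : Type _ := Quotient P.degreeSetoid

/-- The universal grading. -/
def deg (i : J) : P.GradingGroup := Quotient.mk P.degreeSetoid i

theorem deg_surjective : Function.Surjective P.deg := Quotient.mk_surjective

theorem deg_eq_deg {i j : J} : P.deg i = P.deg j ↔ ∃ a, P.Adjoint a ∧ P.prod a i j :=
  Quotient.eq (r := P.degreeSetoid)

instance [Finite J] : Finite P.GradingGroup := Finite.of_surjective P.deg P.deg_surjective

noncomputable instance : Mul P.GradingGroup where
  mul := Quotient.map₂ (fun i j => (P.nonempty i j).choose) fun i i' hi j j' hj =>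
    P.degreeSetoid_prod hi hj (P.nonempty i j).choose_spec (P.nonempty i' j').choose_spec

instance : One P.GradingGroup where one := P.deg P.one

instance : Inv P.GradingGroup where
  inv := Quotient.map P.star fun i j ⟨a, ha, h⟩ => by
    obtain ⟨a', ha', h'⟩ := ha.star.normal (P.star_prod_star h)
    exact ⟨a', ha', h'⟩

variable {P} in
theorem deg_mul {i j l : J} (h : P.prod i j l) : P.deg i * P.deg j = P.deg l :=
  Quotient.sound (s := P.degreeSetoid) (P.degreeSetoid_of_prod (P.nonempty i j).choose_spec h)

theorem deg_one : P.deg P.one = 1 := rfl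

theorem deg_star (i : J) : P.deg (P.star i) = (P.deg i)⁻¹ := rfl

noncomputable instance : Group P.GradingGroup :=
  Group.ofLeftAxioms
    (fun a b c => by
      obtain ⟨i, rfl⟩ := P.deg_surjective a
      obtain ⟨j, rfl⟩ := P.deg_surjective b
      obtain ⟨l, rfl⟩ := P.deg_surjective c
      obtain ⟨m, hm⟩ := P.nonempty i j
      obtain ⟨p, hp⟩ := P.nonempty m l
      obtain ⟨q, hq, hq'⟩ := (P.assoc _ _ _ _).1 ⟨m, hm, hp⟩
      rw [deg_mul hm, deg_mul hp, deg_mul hq, deg_mul hq'])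
    (fun a => by
      obtain ⟨i, rfl⟩ := P.deg_surjective a
      rw [← deg_one, deg_mul (P.one_prod_self i)])
    (fun a => by
      obtain ⟨i, rfl⟩ := P.deg_surjective a
      have := P.prod_star_self (P.star i)
      rw [star_star] at this
      rw [← deg_star, deg_mul this, deg_one])

theorem deg_eq_one {a : J} : P.deg a = 1 ↔ P.Adjoint a := by
  rw [eq_comm, ← deg_one, deg_eq_deg]
  constructor
  · rintro ⟨b, hb, h⟩
    exact .mul hb .one h
  · exact fun ha => ⟨a, ha, P.prod_one.2 rfl⟩

end Polygroup

/-! ### Simple representations, Schur's lemma and density -/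

namespace HopfRep

section SimpleClasses

variable {k : Type u} {H : Type v} [Field k] [Ring H] [Algebra k H]

variable (k H) in
/-- The isomorphism classes of simple representations, as elements of the skeleton. -/
def SimpleClass : Type (max (u + 1) v) :=
  {s : Skeleton (HopfRep.{u, v} k H) // Simple ((fromSkeleton _).obj s)}

namespace SimpleClass

/-- A representative of an isomorphism class of simple representations. -/
noncomputable def rep (j : SimpleClass k H) : HopfRep.{u, v} k H := (fromSkeleton _).obj j.1

theorem simple (j : SimpleClass k H) : Simple j.rep := j.2

instance (j : SimpleClass k H) : IsSimpleModule H j.rep.V := (simple_iff _).1 j.simple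

/-- The class of a simple representation. -/
noncomputable def mk (X : HopfRep.{u, v} k H) (hX : Simple X) : SimpleClass k H :=
  ⟨toSkeleton X, Simple.of_iso (fromSkeletonToSkeletonIso X)⟩

/-- The representative of the class of `X` is isomorphic to `X`. -/
noncomputable def repMkIso (X : HopfRep.{u, v} k H) (hX : Simple X) : (mk X hX).rep ≅ X :=
  fromSkeletonToSkeletonIso X

theorem toSkeleton_rep (j : SimpleClass k H) : toSkeleton j.rep = j.1 :=
  toSkeleton_fromSkeleton_obj j.1

theorem eq_of_iso {i j : SimpleClass k H} (e : i.rep ≅ j.rep) : i = j := by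
  apply Subtype.ext
  rw [← toSkeleton_rep i, ← toSkeleton_rep j]
  exact congr_toSkeleton_of_iso e

@[simp] theorem mk_rep (j : SimpleClass k H) (hj : Simple j.rep) : mk j.rep hj = j :=
  Subtype.ext (toSkeleton_rep j)

theorem mk_eq_mk {X Y : HopfRep.{u, v} k H} (hX : Simple X) (hY : Simple Y) (e : X ≅ Y) :
    mk X hX = mk Y hY := Subtype.ext (congr_toSkeleton_of_iso e)

/-- Schur's lemma for distinct simple representations. -/
theorem hom_eq_zero {i j : SimpleClass k H} (hij : i ≠ j) (f : i.rep.V →ₗ[H] j.rep.V) :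
    f = 0 := by
  by_contra hf
  exact hij (eq_of_iso
    (isoOfLinearEquiv (LinearEquiv.ofBijective f (LinearMap.bijective_of_ne_zero hf))))

end SimpleClass

theorem simple_isIso_of_ne_zero {X Y : HopfRep.{u, v} k H} (hX : Simple X) (hY : Simple Y)
    (f : X ⟶ Y) (hf : f ≠ 0) : Nonempty (X ≅ Y) := by
  rw [simple_iff] at hX hY
  exact ⟨isoOfLinearEquiv (LinearEquiv.ofBijective (toLin f)
    (LinearMap.bijective_of_ne_zero fun h => hf (toLin_eq_zero.1 h)))⟩

theorem ρ_hom {X Y : HopfRep.{u, v} k H} (f : X ⟶ Y) (h : H) (x : X.V) :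
    Y.ρ h (toLin f x) = toLin f (X.ρ h x) := ((toLin f).map_smul h x).symm

theorem ρ_eq_smul_of_injective {X Y : HopfRep.{u, v} k H} (f : X ⟶ Y)
    (hf : Function.Injective (toLin f)) {h : H} {c : k} (hY : Y.ρ h = c • 1) : X.ρ h = c • 1 :=
  LinearMap.ext fun x => hf <| by
    rw [← ρ_hom, hY]
    exact ((linearMap f).map_smul c x).symm

theorem ρ_eq_smul_of_surjective {X Y : HopfRep.{u, v} k H} (f : X ⟶ Y)
    (hf : Function.Surjective (toLin f)) {h : H} {c : k} (hX : X.ρ h = c • 1) : Y.ρ h = c • 1 :=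
  LinearMap.ext fun y => by
    obtain ⟨x, rfl⟩ := hf y
    rw [ρ_hom, hX]
    exact (linearMap f).map_smul c x

theorem ρ_eq_smul_of_iso {X Y : HopfRep.{u, v} k H} (e : X ≅ Y) {h : H} {c : k}
    (hX : X.ρ h = c • 1) : Y.ρ h = c • 1 :=
  ρ_eq_smul_of_surjective e.hom (linearEquivOfIso e).surjective hX

theorem surjective_of_simple {X Y : HopfRep.{u, v} k H} (hY : Simple Y) (f : X ⟶ Y)
    (hf : f ≠ 0) : Function.Surjective (toLin f) := by
  rw [simple_iff] at hY
  exact LinearMap.surjective_of_ne_zero fun h => hf (toLin_eq_zero.1 h)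

theorem injective_of_simple {X Y : HopfRep.{u, v} k H} (hX : Simple X) (f : X ⟶ Y)
    (hf : f ≠ 0) : Function.Injective (toLin f) := by
  rw [simple_iff] at hX
  exact LinearMap.injective_of_ne_zero fun h => hf (toLin_eq_zero.1 h)

theorem nontrivial_of_simple {X : HopfRep.{u, v} k H} (hX : Simple X) : Nontrivial X.V := by
  rw [simple_iff] at hX
  exact IsSimpleModule.nontrivial H X.V

theorem eq_of_smul_one_eq {X : HopfRep.{u, v} k H} (hX : Simple X) {c d : k}
    (h : (c • 1 : Module.End k X.V) = d • 1) : c = d := by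
  have := nontrivial_of_simple hX
  exact smul_left_injective k (one_ne_zero (α := Module.End k X.V)) h

/-- By semisimplicity, a simple representation is a quotient if and only if it is a
subrepresentation. -/
theorem exists_hom_symm [IsSemisimpleRing H] {X Z : HopfRep.{u, v} k H} (hZ : Simple Z) :
    (∃ f : X ⟶ Z, f ≠ 0) ↔ ∃ f : Z ⟶ X, f ≠ 0 := by
  have := nontrivial_of_simple hZ
  have hne : (LinearMap.id : Z.V →ₗ[H] Z.V) ≠ 0 := fun h => by
    obtain ⟨x, hx⟩ := exists_ne (0 : Z.V)
    exact hx (LinearMap.congr_fun h x)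
  constructor
  · rintro ⟨f, hf⟩
    obtain ⟨g, hg⟩ := IsSemisimpleModule.lifting_property (toLin f) (surjective_of_simple hZ f hf)
      LinearMap.id
    refine ⟨ofLin g, fun h => hne ?_⟩
    rw [← hg, ← toLin_ofLin g, h, toLin_zero, LinearMap.comp_zero]
  · rintro ⟨f, hf⟩
    obtain ⟨g, hg⟩ := IsSemisimpleModule.extension_property (toLin f)
      (injective_of_simple hZ f hf) LinearMap.id
    refine ⟨ofLin g, fun h => hne ?_⟩
    rw [← hg, ← toLin_ofLin g, h, toLin_zero, LinearMap.zero_comp]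

/-- In a direct sum `Z = X ⊕ Y`, a nonzero morphism from `Z` is nonzero on a summand. -/
theorem hom_ne_zero_of_isDirectSum {X Y Z W : HopfRep.{u, v} k H} (h : IsDirectSum Z X Y)
    (f : Z ⟶ W) (hf : f ≠ 0) : (∃ g : X ⟶ W, g ≠ 0) ∨ ∃ g : Y ⟶ W, g ≠ 0 := by
  obtain ⟨i, j, p, q, -, -, -, -, hid⟩ := h
  by_contra! hcon
  apply hf
  rw [← Category.id_comp f, ← hid, Preadditive.add_comp, Category.assoc, Category.assoc,
    hcon.1 (i ≫ f), hcon.2 (j ≫ f)]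
  exact toLin_injective (by ext; simp)

/-- Schur's lemma: central elements act on simple representations by scalars. -/
theorem exists_ρ_eq_smul_of_central [IsAlgClosed k] {X : HopfRep.{u, v} k H} (hX : Simple X)
    {h : H} (hh : ∀ a : H, a * h = h * a) : ∃ c : k, X.ρ h = c • 1 := by
  rw [simple_iff] at hX
  let f : Module.End H X.V :=
    { toFun := X.ρ h
      map_add' := map_add _
      map_smul' := fun a x => by
        rw [RingHom.id_apply, smul_eq, smul_eq, ← Module.End.mul_apply, ← map_mul, ← hh, map_mul,
          Module.End.mul_apply] }
  obtain ⟨c, hc⟩ := (IsSimpleModule.algebraMap_end_bijective_of_isAlgClosed (A := H) k).2 f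
  exact ⟨c, LinearMap.ext fun x => (LinearMap.congr_fun hc x).symm⟩

/-- Density: an element of `H` can act by arbitrary scalars on finitely many pairwise nonisomorphic
simple representations. -/
theorem exists_ρ_eq_smul_finset (s : Finset (SimpleClass k H)) (c : SimpleClass k H → k) :
    ∃ h : H, ∀ j ∈ s, j.rep.ρ h = c j • 1 := by
  classical
  let M := ∀ j : s, j.1.rep.V
  let T : Module.End (Module.End H M) M :=
    { toFun := fun x j => c j • x j
      map_add' := fun x y => funext fun j => smul_add _ _ _
      map_smul' := fun φ x => by
        funext i
        -- the off-diagonal entries of `φ` vanish by Schur's lemma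
        have key : ∀ y : M, φ y i = φ (Pi.single i (y i)) i := by
          intro y
          conv_lhs => rw [← Finset.univ_sum_single y, map_sum, Finset.sum_apply]
          refine Finset.sum_eq_single i (fun j _ hji => ?_) (by simp)
          have hne : j.1 ≠ i.1 := fun h => hji (Subtype.ext h)
          exact LinearMap.congr_fun (SimpleClass.hom_eq_zero hne
            (LinearMap.proj i ∘ₗ φ ∘ₗ LinearMap.single H (fun j : s => j.1.rep.V) j)) (y j)
        change c i • φ x i = φ (fun j => c j • x j) i
        rw [key x, key fun j => c j • x j]
        have : (Pi.single i (c i • x i) : M) = c i • Pi.single i (x i) := Pi.single_smul i _ _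
        rw [this, LinearMap.map_smul_of_tower]
        rfl }
  let B := Module.finBasis k M
  obtain ⟨h, hh⟩ := jacobson_density T (Finset.univ.image B)
  refine ⟨h, fun j hj => LinearMap.ext fun x => ?_⟩
  have hB : ∀ y : M, T y = h • y := by
    intro y
    rw [← B.sum_repr y, Finset.smul_sum, map_sum]
    refine Finset.sum_congr rfl fun n _ => ?_
    have h1 := hh (B n) (Finset.mem_image_of_mem B (Finset.mem_univ n))
    rw [smul_comm h, ← h1]
    funext i
    exact smul_comm _ _ _
  have := congrFun (hB (Pi.single ⟨j, hj⟩ x)) ⟨j, hj⟩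
  change c j • (Pi.single ⟨j, hj⟩ x : M) ⟨j, hj⟩ = h • (Pi.single ⟨j, hj⟩ x : M) ⟨j, hj⟩ at this
  rw [Pi.single_eq_same] at this
  exact this.symm

/-- The character of a representation. -/
noncomputable def character (X : HopfRep.{u, v} k H) : H →ₗ[k] k :=
  LinearMap.trace k X.V ∘ₗ X.ρ.toLinearMap

theorem character_apply (X : HopfRep.{u, v} k H) (h : H) :
    X.character h = LinearMap.trace k X.V (X.ρ h) := rfl

theorem character_of_isDirectSum {Z X Y : HopfRep.{u, v} k H} (h : IsDirectSum Z X Y) :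
    Z.character = X.character + Y.character := by
  obtain ⟨i, j, p, q, hip, hjq, -, -, hid⟩ := h
  ext a
  have e : Z.ρ a = (linearMap i ∘ₗ X.ρ a) ∘ₗ linearMap p +
      (linearMap j ∘ₗ Y.ρ a) ∘ₗ linearMap q := by
    ext z
    have h1 : linearMap i (linearMap p z) + linearMap j (linearMap q z) = z :=
      LinearMap.congr_fun (congrArg linearMap hid) z
    conv_lhs => rw [← h1]
    rw [map_add, ← linearMap_comm i, ← linearMap_comm j]
    rfl
  have e1 : linearMap p ∘ₗ linearMap i = LinearMap.id := congrArg linearMap hip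
  have e2 : linearMap q ∘ₗ linearMap j = LinearMap.id := congrArg linearMap hjq
  rw [LinearMap.add_apply, character_apply, e, map_add,
    LinearMap.trace_comp_comm' (linearMap p), LinearMap.trace_comp_comm' (linearMap q),
    ← LinearMap.comp_assoc, ← LinearMap.comp_assoc, e1, e2, LinearMap.id_comp, LinearMap.id_comp]
  rfl

theorem character_of_iso {X Y : HopfRep.{u, v} k H} (e : X ≅ Y) : X.character = Y.character := by
  ext a
  have h1 : X.ρ a = (linearMap e.inv ∘ₗ Y.ρ a) ∘ₗ linearMap e.hom := by
    ext x
    rw [LinearMap.comp_apply, LinearMap.comp_apply, ← linearMap_comm]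
    exact (LinearMap.congr_fun (congrArg linearMap e.hom_inv_id) _).symm
  have e1 : linearMap e.hom ∘ₗ linearMap e.inv = LinearMap.id := congrArg linearMap e.inv_hom_id
  rw [character_apply, h1, LinearMap.trace_comp_comm' (linearMap e.hom), ← LinearMap.comp_assoc, e1,
    LinearMap.id_comp]
  rfl

theorem finrank_cast_ne_zero [CharZero k] {X : HopfRep.{u, v} k H} (hX : Simple X) :
    (Module.finrank k X.V : k) ≠ 0 := by
  have := nontrivial_of_simple hX
  exact_mod_cast Module.finrank_pos.ne'

variable (k H) in
theorem linearIndependent_character [CharZero k] :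
    LinearIndependent k fun j : SimpleClass k H => j.rep.character := by
  classical
  rw [linearIndependent_iff']
  intro s g hg i hi
  obtain ⟨h, hh⟩ := exists_ρ_eq_smul_finset s (Pi.single i (1 : k) : SimpleClass k H → k)
  have h1 := LinearMap.congr_fun hg h
  rw [LinearMap.sum_apply, Finset.sum_eq_single i] at h1
  · rw [LinearMap.smul_apply, character_apply, hh i hi, Pi.single_eq_same, one_smul,
      LinearMap.trace_one, LinearMap.zero_apply, smul_eq_mul, mul_eq_zero] at h1
    exact h1.resolve_right (finrank_cast_ne_zero i.simple)
  · intro j hj hji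
    rw [LinearMap.smul_apply, character_apply, hh j hj, Pi.single_eq_of_ne hji, zero_smul, map_zero,
      smul_zero]
  · exact fun h => absurd hi h

instance [CharZero k] [Module.Finite k H] : Finite (SimpleClass k H) :=
  (linearIndependent_character k H).finite_of_isNoetherian

/-- An element of `H` can be found that acts by prescribed scalars on the simple representations. -/
theorem exists_ρ_eq_smul [CharZero k] [Module.Finite k H] (c : SimpleClass k H → k) :
    ∃ h : H, ∀ (X : HopfRep.{u, v} k H) (hX : Simple X), X.ρ h = c (.mk X hX) • 1 := by
  have := Fintype.ofFinite (SimpleClass k H)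
  obtain ⟨h, hh⟩ := exists_ρ_eq_smul_finset Finset.univ c
  exact ⟨h, fun X hX => ρ_eq_smul_of_iso (SimpleClass.repMkIso X hX) (hh _ (Finset.mem_univ _))⟩

variable (k H) in
/-- The regular representation, on a vector space in the universe of `k`. -/
noncomputable def regular [Module.Finite k H] : HopfRep.{u, v} k H where
  V := Fin (Module.finrank k H) → k
  ρ := ((Module.finBasis k H).equivFun.conjAlgEquiv k : _ →ₐ[k] _).comp (Algebra.lmul k H)

variable (k H) in
/-- The identification of `H` with the space of the regular representation. -/
noncomputable def regularEquiv [Module.Finite k H] : H ≃ₗ[k] (regular k H).V :=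
  (Module.finBasis k H).equivFun

theorem regular_ρ [Module.Finite k H] (a b : H) :
    (regular k H).ρ a (regularEquiv k H b) = regularEquiv k H (a * b) := by
  change regularEquiv k H (a * (regularEquiv k H).symm (regularEquiv k H b)) = _
  rw [LinearEquiv.symm_apply_apply]

theorem ρ_congr_of_simple [IsSemisimpleRing H] {a b : H}
    (h : ∀ X : HopfRep.{u, v} k H, Simple X → X.ρ a = X.ρ b) (X : HopfRep.{u, v} k H) :
    X.ρ a = X.ρ b := by
  induction X using induction_simple with
  | zero X hX => exact LinearMap.ext fun x => Subsingleton.elim _ _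
  | simple X hX => exact h X hX
  | directSum Z X Y hZ ihX ihY =>
    obtain ⟨i, j, p, q, -, -, -, -, hid⟩ := hZ
    ext z
    have h1 : linearMap i (linearMap p z) + linearMap j (linearMap q z) = z :=
      LinearMap.congr_fun (congrArg linearMap hid) z
    rw [← h1, map_add, map_add, ← linearMap_comm i, ← linearMap_comm i, ← linearMap_comm j,
      ← linearMap_comm j, ihX, ihY]

/-- The simple representations are jointly faithful. -/
theorem eq_of_ρ_eq [IsSemisimpleRing H] [Module.Finite k H] {a b : H}
    (h : ∀ X : HopfRep.{u, v} k H, Simple X → X.ρ a = X.ρ b) : a = b := by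
  have := LinearMap.congr_fun (ρ_congr_of_simple h (regular k H))
    (regularEquiv k H 1)
  rw [regular_ρ, regular_ρ, mul_one, mul_one] at this
  exact (regularEquiv k H).injective this

theorem tensorAct_congr_of_simple [IsSemisimpleRing H] {s t : H ⊗[k] H}
    (h : ∀ X Y : HopfRep.{u, v} k H, Simple X → Simple Y →
      tensorAct X.ρ Y.ρ s = tensorAct X.ρ Y.ρ t) (X Y : HopfRep.{u, v} k H) :
    tensorAct X.ρ Y.ρ s = tensorAct X.ρ Y.ρ t := by
  induction X using induction_simple with
  | zero X hX =>
    apply TensorProduct.ext'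
    intro x y
    rw [Subsingleton.elim x 0, TensorProduct.zero_tmul, map_zero, map_zero]
  | directSum Z X X' hZ ihX ihY =>
    obtain ⟨i, j, p, q, -, -, -, -, hid⟩ := hZ
    apply TensorProduct.ext'
    intro z y
    have h1 : linearMap i (linearMap p z) + linearMap j (linearMap q z) = z :=
      LinearMap.congr_fun (congrArg linearMap hid) z
    have key : ∀ {X : HopfRep.{u, v} k H} (i : X ⟶ Z) (t : H ⊗[k] H) (x : X.V),
        tensorAct Z.ρ Y.ρ t (linearMap i x ⊗ₜ y) =
          TensorProduct.map (linearMap i) LinearMap.id (tensorAct X.ρ Y.ρ t (x ⊗ₜ y)) :=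
      fun {X} i t x => (LinearMap.congr_fun (tensorAct_map (f := X.ρ) (f' := Z.ρ) (g := Y.ρ)
        (g' := Y.ρ) (linearMap i) i.2 LinearMap.id (fun _ => rfl) t) (x ⊗ₜ y)).symm
    rw [← h1, TensorProduct.add_tmul, map_add, map_add, key, key, key, key, ihX, ihY]
  | simple X hX =>
    induction Y using induction_simple with
    | zero Y hY =>
      apply TensorProduct.ext'
      intro x y
      rw [Subsingleton.elim y 0, TensorProduct.tmul_zero, map_zero, map_zero]
    | simple Y hY => exact h X Y hX hY
    | directSum Z Y Y' hZ ihX ihY =>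
      obtain ⟨i, j, p, q, -, -, -, -, hid⟩ := hZ
      apply TensorProduct.ext'
      intro x z
      have h1 : linearMap i (linearMap p z) + linearMap j (linearMap q z) = z :=
        LinearMap.congr_fun (congrArg linearMap hid) z
      have key : ∀ {Y : HopfRep.{u, v} k H} (i : Y ⟶ Z) (t : H ⊗[k] H) (y : Y.V),
          tensorAct X.ρ Z.ρ t (x ⊗ₜ linearMap i y) =
            TensorProduct.map LinearMap.id (linearMap i) (tensorAct X.ρ Y.ρ t (x ⊗ₜ y)) :=
        fun {Y} i t y => (LinearMap.congr_fun (tensorAct_map (f := X.ρ) (f' := X.ρ) (g := Y.ρ)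
          (g' := Z.ρ) LinearMap.id (fun _ => rfl) (linearMap i) i.2 t) (x ⊗ₜ y)).symm
      rw [← h1, TensorProduct.tmul_add, map_add, map_add, key, key, key, key, ihX, ihY]

/-- The tensor products of simple representations are jointly faithful for `H ⊗ H`. -/
theorem eq_of_tensorAct_eq [IsSemisimpleRing H] [Module.Finite k H] {s t : H ⊗[k] H}
    (h : ∀ X Y : HopfRep.{u, v} k H, Simple X → Simple Y →
      tensorAct X.ρ Y.ρ s = tensorAct X.ρ Y.ρ t) : s = t := by
  let e := regularEquiv k H
  have key : ∀ t : H ⊗[k] H, tensorAct (regular k H).ρ (regular k H).ρ t (e 1 ⊗ₜ e 1) =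
      TensorProduct.congr e e t := by
    intro t
    induction t with
    | zero => simp only [map_zero, LinearMap.zero_apply]
    | add s t hs ht => simp only [map_add, LinearMap.add_apply, hs, ht]
    | tmul a b =>
      rw [tensorAct_tmul, TensorProduct.map_tmul, regular_ρ, regular_ρ, mul_one, mul_one]
      rfl
  apply (TensorProduct.congr e e).injective
  rw [← key, ← key, tensorAct_congr_of_simple h]

end SimpleClasses

end HopfRep

/-! ### The polygroup of simple representations -/

namespace HopfRep

section Bialgebra

variable {k : Type u} {H : Type v} [Field k] [Ring H] [Bialgebra k H]

instance : MonoidalPreadditive (HopfRep.{u, v} k H) where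
  whiskerLeft_zero := hom_ext (TensorProduct.map_zero_right _)
  zero_whiskerRight := hom_ext (TensorProduct.map_zero_left _)
  whiskerLeft_add _ _ := hom_ext (TensorProduct.map_add_right _ _ _)
  add_whiskerRight _ _ := hom_ext (TensorProduct.map_add_left _ _ _)

theorem tensor_ρ (X Y : HopfRep.{u, v} k H) (h : H) :
    (X ⊗ Y).ρ h = tensorAct X.ρ Y.ρ (Coalgebra.comul h) := rfl

theorem unit_ρ (h : H) :
    (𝟙_ (HopfRep.{u, v} k H)).ρ h = Coalgebra.counit (R := k) h • 1 := rfl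

theorem unit_simple : Simple (𝟙_ (HopfRep.{u, v} k H)) := by
  rw [simple_iff]
  have hnt : Nontrivial (𝟙_ (HopfRep.{u, v} k H)).V := inferInstanceAs (Nontrivial k)
  refine { eq_bot_or_eq_top := fun N => or_iff_not_imp_left.2 fun hN => ?_ }
  obtain ⟨x, hx, hx0⟩ := (Submodule.ne_bot_iff N).1 hN
  rw [eq_top_iff]
  intro y _
  have : y = (show k from y) • (show k from x)⁻¹ • x :=
    (by rw [smul_eq_mul, smul_eq_mul, inv_mul_cancel₀ hx0, mul_one] :
      (show k from y) = (show k from y) • (show k from x)⁻¹ • (show k from x))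
  rw [this]
  exact (N.restrictScalars k).smul_mem _ ((N.restrictScalars k).smul_mem _ hx)

/-- There is a nonzero morphism from `X` to `Y`. -/
def HasHom (X Y : HopfRep.{u, v} k H) : Prop := ∃ f : X ⟶ Y, f ≠ 0

theorem HasHom.of_iso {X Y X' Y' : HopfRep.{u, v} k H} (h : HasHom X Y) (e : X ≅ X')
    (e' : Y ≅ Y') : HasHom X' Y' := by
  obtain ⟨f, hf⟩ := h
  refine ⟨e.inv ≫ f ≫ e'.hom, fun h0 => hf ?_⟩
  rwa [Iso.inv_comp_eq, Limits.comp_zero, ← Iso.eq_comp_inv, Limits.zero_comp] at h0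

theorem HasHom.comp_surjective {X Y Z : HopfRep.{u, v} k H} (h : HasHom Y Z) (g : X ⟶ Y)
    (hg : Function.Surjective (toLin g)) : HasHom X Z := by
  obtain ⟨f, hf⟩ := h
  refine ⟨g ≫ f, fun h0 => hf (toLin_injective (LinearMap.ext fun y => ?_))⟩
  obtain ⟨x, rfl⟩ := hg y
  exact LinearMap.congr_fun (congrArg toLin h0) x

theorem HasHom.of_isDirectSum_left {X Y Z W : HopfRep.{u, v} k H} (hZ : IsDirectSum Z X Y)
    (h : HasHom X W) : HasHom Z W := by
  obtain ⟨f, hf⟩ := h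
  obtain ⟨i, j, p, q, hip, -, -, -, -⟩ := hZ
  refine ⟨p ≫ f, fun h0 => hf ?_⟩
  rw [← Category.id_comp f, ← hip, Category.assoc, h0, Limits.comp_zero]

theorem isDirectSum_symm {X Y Z : HopfRep.{u, v} k H} (h : IsDirectSum Z X Y) :
    IsDirectSum Z Y X := by
  obtain ⟨i, j, p, q, h1, h2, h3, h4, h5⟩ := h
  exact ⟨j, i, q, p, h2, h1, h4, h3, by rw [add_comm, h5]⟩

theorem isDirectSum_whiskerLeft {X Y Z : HopfRep.{u, v} k H} (W : HopfRep.{u, v} k H)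
    (h : IsDirectSum Z X Y) : IsDirectSum (W ⊗ Z) (W ⊗ X) (W ⊗ Y) := by
  obtain ⟨i, j, p, q, h1, h2, h3, h4, h5⟩ := h
  refine ⟨W ◁ i, W ◁ j, W ◁ p, W ◁ q, ?_, ?_, ?_, ?_, ?_⟩ <;>
    simp only [← MonoidalCategory.whiskerLeft_comp, ← MonoidalPreadditive.whiskerLeft_add, h1, h2,
      h3, h4, h5, MonoidalCategory.whiskerLeft_id, MonoidalPreadditive.whiskerLeft_zero]

theorem isDirectSum_whiskerRight {X Y Z : HopfRep.{u, v} k H} (W : HopfRep.{u, v} k H)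
    (h : IsDirectSum Z X Y) : IsDirectSum (Z ⊗ W) (X ⊗ W) (Y ⊗ W) := by
  obtain ⟨i, j, p, q, h1, h2, h3, h4, h5⟩ := h
  refine ⟨i ▷ W, j ▷ W, p ▷ W, q ▷ W, ?_, ?_, ?_, ?_, ?_⟩ <;>
    simp only [← MonoidalCategory.comp_whiskerRight, ← MonoidalPreadditive.add_whiskerRight, h1,
      h2, h3, h4, h5, MonoidalCategory.id_whiskerRight, MonoidalPreadditive.zero_whiskerRight]

theorem not_hasHom_of_subsingleton {X Y : HopfRep.{u, v} k H} (hX : Subsingleton X.V) :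
    ¬ HasHom X Y := fun ⟨f, hf⟩ => hf <| toLin_injective <| LinearMap.ext fun x => by
  rw [Subsingleton.elim x 0, map_zero, map_zero]

theorem HasHom.symm [IsSemisimpleRing H] {X Z : HopfRep.{u, v} k H} (h : HasHom X Z)
    (hZ : Simple Z) : HasHom Z X := (exists_hom_symm hZ).1 h

theorem HasHom.symm' [IsSemisimpleRing H] {X Z : HopfRep.{u, v} k H} (h : HasHom Z X)
    (hZ : Simple Z) : HasHom X Z := (exists_hom_symm hZ).2 h

theorem HasHom.self_of_simple {X : HopfRep.{u, v} k H} (hX : Simple X) : HasHom X X :=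
  ⟨𝟙 X, id_nonzero X⟩

namespace SimpleClass

theorem hasHom_iff {X : HopfRep.{u, v} k H} (hX : Simple X) (j : SimpleClass k H) :
    HasHom X j.rep ↔ mk X hX = j := by
  constructor
  · rintro ⟨f, hf⟩
    obtain ⟨e⟩ := simple_isIso_of_ne_zero hX j.simple f hf
    rw [mk_eq_mk hX j.simple e]
    exact mk_rep j j.simple
  · rintro rfl
    exact (HasHom.self_of_simple hX).of_iso (Iso.refl X) (repMkIso X hX).symm

end SimpleClass

theorem exists_hasHom_of_nontrivial [IsSemisimpleRing H] (X : HopfRep.{u, v} k H)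
    [Nontrivial X.V] : ∃ j : SimpleClass k H, HasHom X j.rep := by
  obtain ⟨N, hN⟩ := IsSemisimpleModule.exists_simple_submodule (R := H) (M := X.V)
  have hs : Simple (ofSubmodule X N) := (simple_iff _).2 hN
  refine ⟨.mk _ hs, HasHom.of_iso (X := X) ?_ (Iso.refl X) (SimpleClass.repMkIso _ hs).symm⟩
  refine HasHom.symm' (X := X) ⟨incl X N, fun h => ?_⟩ hs
  have := nontrivial_of_simple hs
  obtain ⟨x, hx⟩ := exists_ne (0 : (ofSubmodule X N).V)
  apply hx
  apply incl_injective X N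
  rw [h, map_zero, toLin_zero, LinearMap.zero_apply]

/-- An element acts by a scalar if it does so on all simple constituents. -/
theorem ρ_eq_smul_of_constituents [IsSemisimpleRing H] {Y : HopfRep.{u, v} k H} {h : H} {c : k}
    (hj : ∀ j : SimpleClass k H, HasHom Y j.rep → j.rep.ρ h = c • 1) : Y.ρ h = c • 1 := by
  induction Y using induction_simple with
  | zero Y hY => exact LinearMap.ext fun x => Subsingleton.elim _ _
  | simple Y hY =>
    exact ρ_eq_smul_of_iso (SimpleClass.repMkIso Y hY) (hj _ ((SimpleClass.hasHom_iff hY _).2 rfl))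
  | directSum Z X Y hZ ihX ihY =>
    have hX := ihX fun j h => hj j (h.of_isDirectSum_left hZ)
    have hY := ihY fun j h => hj j (h.of_isDirectSum_left (isDirectSum_symm hZ))
    obtain ⟨i, j, p, q, -, -, -, -, hid⟩ := hZ
    ext z
    have h1 : linearMap i (linearMap p z) + linearMap j (linearMap q z) = z :=
      LinearMap.congr_fun (congrArg linearMap hid) z
    rw [← h1, map_add, map_add, ← linearMap_comm i, ← linearMap_comm j, hX, hY]
    simp

/-- If a nonzero morphism starts at `W ⊗ Y`, then also at `W ⊗ Z` for a simple constituent `Z` of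
`Y`. -/
theorem HasHom.exists_left [IsSemisimpleRing H] {W Y Z : HopfRep.{u, v} k H}
    (h : HasHom (W ⊗ Y) Z) : ∃ j : SimpleClass k H, HasHom Y j.rep ∧ HasHom (W ⊗ j.rep) Z := by
  induction Y using induction_simple with
  | zero Y hY =>
    refine absurd h (not_hasHom_of_subsingleton ?_)
    change Subsingleton (W.V ⊗[k] Y.V)
    infer_instance
  | simple Y hY =>
    exact ⟨.mk Y hY, (SimpleClass.hasHom_iff hY _).2 rfl,
      h.of_iso (whiskerLeftIso W (SimpleClass.repMkIso Y hY).symm) (Iso.refl Z)⟩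
  | directSum Y X X' hY ihX ihY =>
    obtain ⟨f, hf⟩ := h
    rcases hom_ne_zero_of_isDirectSum (isDirectSum_whiskerLeft W hY) f hf with h | h
    · obtain ⟨j, hj, hj'⟩ := ihX h
      exact ⟨j, hj.of_isDirectSum_left hY, hj'⟩
    · obtain ⟨j, hj, hj'⟩ := ihY h
      exact ⟨j, hj.of_isDirectSum_left (isDirectSum_symm hY), hj'⟩

/-- If a nonzero morphism starts at `Y ⊗ W`, then also at `Z ⊗ W` for a simple constituent `Z` of
`Y`. -/
theorem HasHom.exists_right [IsSemisimpleRing H] {W Y Z : HopfRep.{u, v} k H}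
    (h : HasHom (Y ⊗ W) Z) : ∃ j : SimpleClass k H, HasHom Y j.rep ∧ HasHom (j.rep ⊗ W) Z := by
  induction Y using induction_simple with
  | zero Y hY =>
    refine absurd h (not_hasHom_of_subsingleton ?_)
    change Subsingleton (Y.V ⊗[k] W.V)
    infer_instance
  | simple Y hY =>
    exact ⟨.mk Y hY, (SimpleClass.hasHom_iff hY _).2 rfl,
      h.of_iso (whiskerRightIso (SimpleClass.repMkIso Y hY).symm W) (Iso.refl Z)⟩
  | directSum Y X X' hY ihX ihY =>
    obtain ⟨f, hf⟩ := h
    rcases hom_ne_zero_of_isDirectSum (isDirectSum_whiskerRight W hY) f hf with h | h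
    · obtain ⟨j, hj, hj'⟩ := ihX h
      exact ⟨j, hj.of_isDirectSum_left hY, hj'⟩
    · obtain ⟨j, hj, hj'⟩ := ihY h
      exact ⟨j, hj.of_isDirectSum_left (isDirectSum_symm hY), hj'⟩

theorem HasHom.comp_whiskerLeft {W X Y Z : HopfRep.{u, v} k H} (hY : Simple Y)
    (h : HasHom (W ⊗ Y) Z) (h' : HasHom X Y) : HasHom (W ⊗ X) Z := by
  obtain ⟨f, hf⟩ := h'
  exact h.comp_surjective (W ◁ f)
    (TensorProduct.map_surjective Function.surjective_id (surjective_of_simple hY f hf))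

theorem HasHom.comp_whiskerRight {W X Y Z : HopfRep.{u, v} k H} (hY : Simple Y)
    (h : HasHom (Y ⊗ W) Z) (h' : HasHom X Y) : HasHom (X ⊗ W) Z := by
  obtain ⟨f, hf⟩ := h'
  exact h.comp_surjective (f ▷ W)
    (TensorProduct.map_surjective (surjective_of_simple hY f hf) Function.surjective_id)

end Bialgebra

section Hopf

variable {k : Type u} {H : Type v} [Field k] [Ring H] [HopfAlgebra k H]

theorem dual_ρ (X : HopfRep.{u, v} k H) (h : H) (f : Module.Dual k X.V) (x : X.V) :
    (show Module.Dual k X.V from (Xᘁ).ρ h f) x = f (X.ρ (HopfAlgebra.antipode k h) x) := rfl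

/-- Duals of simple representations are simple: the annihilator in `X` of a subrepresentation of
`X*` is a subrepresentation, the antipode being surjective. -/
theorem dual_simple [IsSemisimpleRing H] {X : HopfRep.{u, v} k H} (hX : Simple X) :
    Simple (Xᘁ) := by
  have := nontrivial_of_simple hX
  rw [simple_iff] at hX ⊢
  have hnt : Nontrivial (Xᘁ).V := inferInstanceAs (Nontrivial (Module.Dual k X.V))
  refine { eq_bot_or_eq_top := fun N => ?_ }
  let N' : Subspace k (Module.Dual k X.V) := N.restrictScalars k
  let A : Submodule H X.V :=
    { N'.dualCoannihilator with
      smul_mem' := by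
        intro h x hx
        obtain ⟨h, rfl⟩ := (antipode_bijective k H).2 h
        refine (Submodule.mem_dualCoannihilator _).2 fun f hf => ?_
        exact (Submodule.mem_dualCoannihilator x).1 hx _ (N.smul_mem h hf) }
  have hA : A.restrictScalars k = N'.dualCoannihilator := rfl
  have hN' : N'.dualCoannihilator.dualAnnihilator = N' :=
    Subspace.dualCoannihilator_dualAnnihilator_eq
  rcases eq_bot_or_eq_top A with h | h
  · right
    have h2 : N'.dualCoannihilator = ⊥ := by rw [← hA, h]; rfl
    rw [h2, Submodule.dualAnnihilator_bot] at hN'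
    rw [eq_top_iff]
    intro f _
    exact hN'.le (Submodule.mem_top (x := f))
  · left
    have h2 : N'.dualCoannihilator = ⊤ := by rw [← hA, h]; rfl
    rw [h2, Submodule.dualAnnihilator_top] at hN'
    rw [Submodule.eq_bot_iff]
    intro f hf
    exact (Submodule.mem_bot k).1 (hN'.ge hf)

theorem HasHom.tensorRight {X Y Z : HopfRep.{u, v} k H} (h : HasHom (X ⊗ Y) Z) :
    HasHom X (Z ⊗ Yᘁ) := by
  obtain ⟨f, hf⟩ := h
  refine ⟨tensorRightHomEquiv X Y Yᘁ Z f, fun h0 => hf ?_⟩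
  rw [← (tensorRightHomEquiv X Y Yᘁ Z).symm_apply_apply f, h0]
  simp [tensorRightHomEquiv]

theorem HasHom.tensorLeft {X Y Z : HopfRep.{u, v} k H} (h : HasHom Z (X ⊗ Y)) :
    HasHom (Xᘁ ⊗ Z) Y := by
  obtain ⟨f, hf⟩ := h
  refine ⟨(tensorLeftHomEquiv Z X Xᘁ Y).symm f, fun h0 => hf ?_⟩
  rw [← (tensorLeftHomEquiv Z X Xᘁ Y).apply_symm_apply f, h0]
  simp [tensorLeftHomEquiv]

variable (k H) in
/-- The polygroup of simple representations: `l` is a value of the product of `i` and `j` if it is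
a constituent of the tensor product. Reversibility comes from the adjunctions between tensoring
with `X` and with `X*`. -/
noncomputable def simplePolygroup [IsSemisimpleRing H] : Polygroup (SimpleClass.{u, v} k H) where
  prod i j l := HasHom (i.rep ⊗ j.rep) l.rep
  one := .mk _ unit_simple
  star i := .mk _ (dual_simple i.simple)
  nonempty i j := by
    have := nontrivial_of_simple i.simple
    have := nontrivial_of_simple j.simple
    have : Nontrivial (i.rep ⊗ j.rep).V := by
      change Nontrivial (i.rep.V ⊗[k] j.rep.V)
      apply Module.nontrivial_of_finrank_pos (R := k)
      rw [Module.finrank_tensorProduct]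
      exact Nat.mul_pos Module.finrank_pos Module.finrank_pos
    exact exists_hasHom_of_nontrivial _
  assoc i j l p := by
    constructor
    · rintro ⟨m, h, h'⟩
      exact ((h'.comp_whiskerRight m.simple h).of_iso (α_ _ _ _) (Iso.refl _)).exists_left
    · rintro ⟨m, h, h'⟩
      exact ((h'.comp_whiskerLeft m.simple h).of_iso (α_ _ _ _).symm (Iso.refl _)).exists_right
  one_prod i j := by
    rw [← SimpleClass.mk_rep i i.simple, ← SimpleClass.hasHom_iff i.simple j, SimpleClass.mk_rep]
    have e : (SimpleClass.mk (𝟙_ (HopfRep.{u, v} k H)) unit_simple).rep ⊗ i.rep ≅ i.rep :=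
      whiskerRightIso (SimpleClass.repMkIso _ unit_simple) i.rep ≪≫ λ_ i.rep
    exact ⟨fun h => h.of_iso e (Iso.refl _), fun h => h.of_iso e.symm (Iso.refl _)⟩
  prod_star {i j l} h := (h.tensorRight.of_iso (Iso.refl _) (whiskerLeftIso l.rep
    (SimpleClass.repMkIso _ (dual_simple j.simple)).symm)).symm' i.simple
  star_prod {i j l} h := (h.symm l.simple).tensorLeft.of_iso (whiskerRightIso
    (SimpleClass.repMkIso _ (dual_simple i.simple)).symm l.rep) (Iso.refl _)

end Hopf

end HopfRep

/-! ### The Grothendieck ring and its components -/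

section GrothendieckRing

theorem AddSubgroup.mul_mem_of_forall_mem_closure {R : Type*} [Ring R] {s t : Set R}
    {M : AddSubgroup R}
    (h : ∀ a ∈ s, ∀ b ∈ t, a * b ∈ M) {x y : R} (hx : x ∈ AddSubgroup.closure s)
    (hy : y ∈ AddSubgroup.closure t) : x * y ∈ M := by
  induction hx using AddSubgroup.closure_induction with
  | zero => rw [zero_mul]; exact zero_mem M
  | add x x' _ _ hx hx' => rw [add_mul]; exact add_mem hx hx'
  | neg x _ hx => rw [neg_mul]; exact neg_mem hx
  | mem x hx =>
    induction hy using AddSubgroup.closure_induction with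
    | zero => rw [mul_zero]; exact zero_mem M
    | add y y' _ _ hy hy' => rw [mul_add]; exact add_mem hy hy'
    | neg y _ hy => rw [mul_neg]; exact neg_mem hy
    | mem y hy => exact h x hx y hy

variable {C : Type u} [Category.{v} C] [Preadditive C] [MonoidalCategory C]

theorem objClass_of_iso {X Y : C} (e : X ≅ Y) : objClass X = objClass Y := by
  rw [objClass, objClass, congr_toSkeleton_of_iso e]

theorem objClass_tensor (X Y : C) : objClass (X ⊗ Y) = objClass X * objClass Y := by
  rw [objClass, objClass, objClass, Skeleton.toSkeleton_tensorObj, map_mul]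
  exact map_mul (Ideal.Quotient.mk (directSumIdeal C).asIdeal) _ _

theorem objClass_unit : objClass (𝟙_ C) = 1 := by
  rw [objClass, ← Skeleton.one_eq, map_one]
  exact map_one (Ideal.Quotient.mk (directSumIdeal C).asIdeal)

theorem objClass_of_isDirectSum {Z X Y : C} (h : IsDirectSum Z X Y) :
    objClass Z = objClass X + objClass Y := by
  have h1 : Ideal.Quotient.mk (directSumIdeal C).asIdeal (MonoidAlgebra.of ℤ _ (toSkeleton Z)) =
      Ideal.Quotient.mk (directSumIdeal C).asIdeal (MonoidAlgebra.of ℤ _ (toSkeleton X) +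
        MonoidAlgebra.of ℤ _ (toSkeleton Y)) := by
    rw [Ideal.Quotient.mk_eq_mk_iff_sub_mem]
    exact TwoSidedIdeal.mem_asIdeal.2 (TwoSidedIdeal.subset_span ⟨Z, X, Y, h, rfl⟩)
  rw [map_add] at h1
  exact h1

end GrothendieckRing

namespace HopfRep

section Bialgebra

variable {k : Type u} {H : Type v} [Field k] [Ring H] [Bialgebra k H]

theorem objClass_of_subsingleton {X : HopfRep.{u, v} k H} (hX : Subsingleton X.V) :
    objClass X = 0 := by
  have h : IsDirectSum X X X := by
    have : ∀ f g : X ⟶ X, f = g := fun f g =>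
      toLin_injective (LinearMap.ext fun x => Subsingleton.elim _ _)
    exact ⟨0, 0, 0, 0, this _ _, this _ _, this _ _, this _ _, this _ _⟩
  simpa using objClass_of_isDirectSum h

theorem character_tensor (X Y : HopfRep.{u, v} k H) :
    WithConv.toConv (X ⊗ Y).character =
      WithConv.toConv X.character * WithConv.toConv Y.character := by
  apply WithConv.ext
  rw [LinearMap.convMul_def]
  ext h
  change LinearMap.trace k (X.V ⊗[k] Y.V) (tensorAct X.ρ Y.ρ (Coalgebra.comul h)) =
    LinearMap.mul' k k (TensorProduct.map X.character Y.character (Coalgebra.comul h))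
  generalize (Coalgebra.comul h : H ⊗[k] H) = t
  induction t with
  | zero => simp
  | add s t hs ht => simp only [map_add, hs, ht]
  | tmul a b =>
    rw [tensorAct_tmul, LinearMap.trace_tensorProduct']
    rfl

theorem character_unit :
    WithConv.toConv (𝟙_ (HopfRep.{u, v} k H)).character = 1 := by
  apply WithConv.ext
  ext h
  change LinearMap.trace k k ((Algebra.lmul k k) (Coalgebra.counit h)) = Coalgebra.counit h
  rw [← mul_one (Coalgebra.counit (R := k) h), ← smul_eq_mul, map_smul, map_smul, map_one,
    LinearMap.trace_one, Module.finrank_self, Nat.cast_one]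

variable (k H) in
/-- Taking characters is a ring homomorphism from the Grothendieck ring to the convolution algebra
`H*`. -/
noncomputable def characterHom :
    GrothendieckRing (HopfRep.{u, v} k H) →+* WithConv (H →ₗ[k] k) :=
  let F : MonoidAlgebra ℤ (Skeleton (HopfRep.{u, v} k H)) →ₐ[ℤ] WithConv (H →ₗ[k] k) :=
    MonoidAlgebra.lift ℤ _ _
      { toFun := fun s => WithConv.toConv ((fromSkeleton _).obj s).character
        map_one' := by
          rw [← character_unit]
          exact congrArg _ (character_of_iso (fromSkeletonToSkeletonIso _))
        map_mul' := fun s t => by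
          rw [← character_tensor]
          exact congrArg _ (character_of_iso (fromSkeletonToSkeletonIso _)) }
  Ideal.Quotient.lift (directSumIdeal (HopfRep.{u, v} k H)).asIdeal F.toRingHom (by
    intro a ha
    have hle : directSumIdeal (HopfRep.{u, v} k H) ≤ TwoSidedIdeal.ker F.toRingHom := by
      refine TwoSidedIdeal.span_le.2 ?_
      rintro _ ⟨Z, X, Y, h, rfl⟩
      refine (TwoSidedIdeal.mem_ker _).2 ?_
      have e : ∀ X : HopfRep.{u, v} k H, F.toRingHom (MonoidAlgebra.of ℤ _ (toSkeleton X)) =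
          WithConv.toConv X.character := fun X => by
        refine (MonoidAlgebra.lift_of _ _).trans ?_
        exact congrArg _ (character_of_iso (fromSkeletonToSkeletonIso _))
      rw [map_sub, map_add, e, e, e, character_of_isDirectSum h]
      exact sub_self _
    exact (TwoSidedIdeal.mem_ker _).1 (hle (TwoSidedIdeal.mem_asIdeal.1 ha)))

theorem characterHom_objClass (X : HopfRep.{u, v} k H) :
    characterHom k H (objClass X) = WithConv.toConv X.character := by
  refine (MonoidAlgebra.lift_of (R := ℤ) _ _).trans ?_
  exact congrArg _ (character_of_iso (fromSkeletonToSkeletonIso _))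

variable (k H) in
/-- The classes of the simple representations are linearly independent, as their characters are. -/
theorem linearIndependent_objClass [CharZero k] :
    LinearIndependent ℤ fun j : SimpleClass.{u, v} k H => objClass j.rep := by
  let χ : GrothendieckRing (HopfRep.{u, v} k H) →+ (H →ₗ[k] k) :=
    { toFun := fun x => (characterHom k H x).ofConv
      map_zero' := by rw [map_zero]; rfl
      map_add' := fun x y => by rw [map_add]; rfl }
  apply LinearIndependent.of_comp χ.toIntLinearMap
  have e : χ.toIntLinearMap ∘ (fun j : SimpleClass.{u, v} k H => objClass j.rep) =
      fun j => j.rep.character := by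
    funext j
    exact congrArg WithConv.ofConv (characterHom_objClass j.rep)
  rw [e]
  refine (linearIndependent_character k H).restrict_scalars fun m n h => ?_
  simpa using h

variable (k H) in
/-- The `ℤ`-span of a set of classes of simple representations. -/
noncomputable def classSpan (s : Set (SimpleClass.{u, v} k H)) :
    AddSubgroup (GrothendieckRing (HopfRep.{u, v} k H)) :=
  AddSubgroup.closure ((fun j => objClass j.rep) '' s)

theorem objClass_mem_classSpan_of_mem {s : Set (SimpleClass.{u, v} k H)} {j : SimpleClass k H}
    (hj : j ∈ s) : objClass j.rep ∈ classSpan k H s :=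
  AddSubgroup.subset_closure ⟨j, hj, rfl⟩

theorem basic_eq (X : {X : HopfRep.{u, v} k H // Simple X}) :
    basic _ X = objClass (SimpleClass.mk X.1 X.2).rep :=
  (objClass_of_iso (SimpleClass.repMkIso X.1 X.2)).symm

theorem isBasedSubgroup_iff (M : AddSubgroup (GrothendieckRing (HopfRep.{u, v} k H))) :
    IsBasedSubgroup (basic _) M ↔ ∃ s, M = classSpan k H s := by
  constructor
  · rintro ⟨s, rfl⟩
    refine ⟨(fun X => SimpleClass.mk X.1 X.2) '' s, ?_⟩
    rw [classSpan, Set.image_image]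
    congr 1
    exact Set.image_congr fun X _ => basic_eq X
  · rintro ⟨s, rfl⟩
    refine ⟨(fun j : SimpleClass k H => ⟨j.rep, j.simple⟩) '' s, ?_⟩
    rw [Set.image_image]
    rfl

theorem objClass_rep_ne_zero [CharZero k] (j : SimpleClass.{u, v} k H) : objClass j.rep ≠ 0 :=
  (linearIndependent_objClass k H).ne_zero j

theorem classSpan_eq_bot_iff [CharZero k] {s : Set (SimpleClass.{u, v} k H)} :
    classSpan k H s = ⊥ ↔ s = ∅ := by
  constructor
  · intro h
    rw [Set.eq_empty_iff_forall_notMem]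
    intro j hj
    have := objClass_mem_classSpan_of_mem hj
    rw [h, AddSubgroup.mem_bot] at this
    exact objClass_rep_ne_zero j this
  · rintro rfl
    rw [classSpan, Set.image_empty, AddSubgroup.closure_empty]

theorem classSpan_union (s t : Set (SimpleClass.{u, v} k H)) :
    classSpan k H (s ∪ t) = classSpan k H s ⊔ classSpan k H t := by
  rw [classSpan, Set.image_union, AddSubgroup.closure_union]
  rfl

theorem classSpan_inf_eq_bot [CharZero k] {s t : Set (SimpleClass.{u, v} k H)}
    (h : Disjoint s t) : classSpan k H s ⊓ classSpan k H t = ⊥ := by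
  have := (linearIndependent_objClass k H).disjoint_span_image h
  rw [AddSubgroup.eq_bot_iff_forall]
  rintro x ⟨h1, h2⟩
  simp only [classSpan, SetLike.mem_coe, ← Submodule.span_int_eq_addSubgroupClosure] at h1 h2
  exact (Submodule.disjoint_def.1 this) x h1 h2

variable [IsSemisimpleRing H]

theorem objClass_mem_classSpan {Y : HopfRep.{u, v} k H} {s : Set (SimpleClass k H)}
    (h : ∀ j : SimpleClass k H, HasHom Y j.rep → j ∈ s) : objClass Y ∈ classSpan k H s := by
  induction Y using induction_simple with
  | zero Y hY => rw [objClass_of_subsingleton hY]; exact zero_mem _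
  | simple Y hY =>
    rw [← objClass_of_iso (SimpleClass.repMkIso Y hY)]
    exact objClass_mem_classSpan_of_mem (h _ ((SimpleClass.hasHom_iff hY _).2 rfl))
  | directSum Z X Y hZ ihX ihY =>
    rw [objClass_of_isDirectSum hZ]
    exact add_mem (ihX fun j hj => h j (hj.of_isDirectSum_left hZ))
      (ihY fun j hj => h j (hj.of_isDirectSum_left (isDirectSum_symm hZ)))

variable [CharZero k] [Module.Finite k H]

/-- A representation whose class lies in the span of a set of basic elements has all its simple
constituents in this set. Otherwise the central idempotent of a missing constituent `j` would act on
`Y` as an idempotent of trace zero, that is, as zero. -/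
theorem mem_of_objClass_mem_classSpan {Y : HopfRep.{u, v} k H} {s : Set (SimpleClass k H)}
    (hY : objClass Y ∈ classSpan k H s) {j : SimpleClass k H} (hj : HasHom Y j.rep) : j ∈ s := by
  classical
  by_contra hjs
  obtain ⟨e, he⟩ := exists_ρ_eq_smul (H := H) (Pi.single j (1 : k) : SimpleClass k H → k)
  have hidem : e * e = e := eq_of_ρ_eq fun X hX => by
    rw [map_mul, he X hX, smul_mul_smul_comm, one_mul, ← Pi.mul_apply, ← Pi.single_mul, one_mul]
  have htrace : ∀ x ∈ classSpan k H s, (characterHom k H x).ofConv e = 0 := by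
    intro x hx
    induction hx using AddSubgroup.closure_induction with
    | mem x hx =>
      obtain ⟨i, hi, rfl⟩ := hx
      have hij : i ≠ j := fun h => hjs (h ▸ hi)
      change (characterHom k H (objClass i.rep)).ofConv e = 0
      rw [characterHom_objClass]
      change LinearMap.trace k i.rep.V (i.rep.ρ e) = 0
      rw [he i.rep i.simple, SimpleClass.mk_rep, Pi.single_eq_of_ne hij, zero_smul, map_zero]
    | zero => rw [map_zero]; rfl
    | add x y _ _ hx hy =>
      rw [map_add, WithConv.ofConv_add, LinearMap.add_apply, hx, hy, add_zero]
    | neg x _ hx =>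
      rw [map_neg, WithConv.ofConv_neg, LinearMap.neg_apply, hx, neg_zero]
  have h0 := htrace _ hY
  rw [characterHom_objClass] at h0
  change LinearMap.trace k Y.V (Y.ρ e) = 0 at h0
  have hid : IsIdempotentElem (Y.ρ e) := by rw [IsIdempotentElem, ← map_mul, hidem]
  have hzero : Y.ρ e = 0 := (LinearMap.IsIdempotentElem.trace_eq_zero_iff hid).1 h0
  obtain ⟨f, hf⟩ := hj
  apply hf
  apply toLin_injective
  ext y
  have h1 := ρ_hom f e y
  rw [hzero, he j.rep j.simple, SimpleClass.mk_rep, Pi.single_eq_same, one_smul,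
    LinearMap.zero_apply, map_zero] at h1
  exact h1

theorem objClass_mem_classSpan_iff {Y : HopfRep.{u, v} k H} {s : Set (SimpleClass k H)} :
    objClass Y ∈ classSpan k H s ↔ ∀ j : SimpleClass k H, HasHom Y j.rep → j ∈ s :=
  ⟨fun h _ => mem_of_objClass_mem_classSpan h, objClass_mem_classSpan⟩

theorem objClass_rep_mem_classSpan_iff {j : SimpleClass.{u, v} k H} {s : Set (SimpleClass k H)} :
    objClass j.rep ∈ classSpan k H s ↔ j ∈ s :=
  ⟨fun h => mem_of_objClass_mem_classSpan h (HasHom.self_of_simple j.simple),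
    objClass_mem_classSpan_of_mem⟩

end Bialgebra

section Hopf

variable {k : Type u} {H : Type v} [Field k] [Ring H] [HopfAlgebra k H] [IsSemisimpleRing H]

theorem basic_mul_basicDual (X : {X : HopfRep.{u, v} k H // Simple X}) :
    basic _ X * basicDual _ X = objClass (SimpleClass.mk X.1 X.2).rep *
      objClass ((simplePolygroup k H).star (.mk X.1 X.2)).rep := by
  rw [basic_eq]
  congr 1
  have e : (SimpleClass.mk X.1 X.2).rep ≅ X.1 := SimpleClass.repMkIso _ _
  have e' : (X.1)ᘁ ≅ ((SimpleClass.mk X.1 X.2).rep)ᘁ :=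
    { hom := rightAdjointMate e.hom
      inv := rightAdjointMate e.inv
      hom_inv_id := by rw [← comp_rightAdjointMate, e.inv_hom_id, rightAdjointMate_id]
      inv_hom_id := by rw [← comp_rightAdjointMate, e.hom_inv_id, rightAdjointMate_id] }
  exact objClass_of_iso (e' ≪≫
    (SimpleClass.repMkIso _ (dual_simple (SimpleClass.simple (.mk X.1 X.2)))).symm)

variable [CharZero k] [Module.Finite k H]

theorem objClass_mul_mem_classSpan_iff {i j : SimpleClass.{u, v} k H} {s : Set (SimpleClass k H)} :
    objClass i.rep * objClass j.rep ∈ classSpan k H s ↔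
      ∀ l, (simplePolygroup k H).prod i j l → l ∈ s := by
  rw [← objClass_tensor, objClass_mem_classSpan_iff]
  rfl

theorem mul_mem_classSpan {s t r : Set (SimpleClass.{u, v} k H)}
    (h : ∀ i ∈ s, ∀ j ∈ t, ∀ l, (simplePolygroup k H).prod i j l → l ∈ r)
    {x y : GrothendieckRing (HopfRep.{u, v} k H)} (hx : x ∈ classSpan k H s)
    (hy : y ∈ classSpan k H t) : x * y ∈ classSpan k H r := by
  refine AddSubgroup.mul_mem_of_forall_mem_closure ?_ hx hy
  rintro _ ⟨i, hi, rfl⟩ _ ⟨j, hj, rfl⟩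
  exact objClass_mul_mem_classSpan_iff.2 (h i hi j hj)

variable (k H) in
/-- The adjoint subring is spanned by the adjoint part of the polygroup of simple
representations. -/
theorem adjointSubring_eq :
    (adjointSubring (basic (HopfRep.{u, v} k H)) (basicDual _)).toAddSubgroup =
      classSpan k H {a | (simplePolygroup k H).Adjoint a} := by
  apply le_antisymm
  · let S : Subring (GrothendieckRing (HopfRep.{u, v} k H)) :=
      { classSpan k H {a | (simplePolygroup k H).Adjoint a} with
        one_mem' := by
          have : objClass (SimpleClass.mk (𝟙_ (HopfRep.{u, v} k H)) unit_simple).rep ∈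
              classSpan k H {a | (simplePolygroup k H).Adjoint a} :=
            objClass_mem_classSpan_of_mem .one
          rwa [objClass_of_iso (SimpleClass.repMkIso _ unit_simple), objClass_unit] at this
        mul_mem' := fun hx hy => mul_mem_classSpan
          (fun i hi j hj l h => .mul hi hj h) hx hy }
    have hS : S ∈ {S : Subring (GrothendieckRing (HopfRep.{u, v} k H)) |
        IsBasedSubgroup (basic _) S.toAddSubgroup ∧ ∀ i, basic _ i * basicDual _ i ∈ S} := by
      refine ⟨(isBasedSubgroup_iff _).2 ⟨_, rfl⟩, fun X => ?_⟩
      rw [basic_mul_basicDual]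
      exact objClass_mul_mem_classSpan_iff.2 fun l h => .pair h
    intro x hx
    exact Subring.mem_sInf.1 hx S hS
  · rw [classSpan, AddSubgroup.closure_le]
    rintro _ ⟨a, ha, rfl⟩
    refine Subring.mem_sInf.2 ?_
    rintro S ⟨hS, hSX⟩
    obtain ⟨s, hs⟩ := (isBasedSubgroup_iff _).1 hS
    have hmem : ∀ x, x ∈ S ↔ x ∈ classSpan k H s := fun x => by
      rw [← hs]; rfl
    rw [hmem]
    refine objClass_mem_classSpan_of_mem ?_
    rw [Set.mem_ofPred_eq] at ha
    induction ha with
    | one =>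
      rw [← objClass_rep_mem_classSpan_iff, ← hmem]
      change objClass (SimpleClass.mk (𝟙_ (HopfRep.{u, v} k H)) unit_simple).rep ∈ S
      rw [objClass_of_iso (SimpleClass.repMkIso _ unit_simple), objClass_unit]
      exact one_mem S
    | @pair i l h =>
      have h1 := hSX ⟨i.rep, i.simple⟩
      rw [basic_mul_basicDual, hmem, SimpleClass.mk_rep] at h1
      exact objClass_mul_mem_classSpan_iff.1 h1 l h
    | @mul a b l _ _ h iha ihb =>
      have ha := (hmem _).2 (objClass_mem_classSpan_of_mem iha)
      have hb := (hmem _).2 (objClass_mem_classSpan_of_mem ihb)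
      exact objClass_mul_mem_classSpan_iff.1 ((hmem _).1 (mul_mem ha hb)) l h

/-- The span of the classes of simple representations of degree `q`. -/
noncomputable def degSpan (q : (simplePolygroup.{u, v} k H).GradingGroup) :
    AddSubgroup (GrothendieckRing (HopfRep.{u, v} k H)) :=
  classSpan k H {j | (simplePolygroup k H).deg j = q}

theorem isBasedSubbimodule_classSpan_iff {s : Set (SimpleClass.{u, v} k H)} :
    IsBasedSubbimodule (basic _) (basicDual _) (classSpan k H s) ↔
      ∀ a, (simplePolygroup k H).Adjoint a → ∀ i ∈ s, ∀ l,
        ((simplePolygroup k H).prod a i l → l ∈ s) ∧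
          ((simplePolygroup k H).prod i a l → l ∈ s) := by
  have hadj : ∀ x, x ∈ adjointSubring (basic (HopfRep.{u, v} k H)) (basicDual _) ↔
      x ∈ classSpan k H {a | (simplePolygroup k H).Adjoint a} := fun x => by
    rw [← adjointSubring_eq]; rfl
  constructor
  · rintro ⟨-, hl, hr⟩ a ha i hi l
    have ha' := (hadj _).2 (objClass_mem_classSpan_of_mem ha)
    have hi' := objClass_mem_classSpan_of_mem hi
    exact ⟨objClass_mul_mem_classSpan_iff.1 (hl _ ha' _ hi') l,
      objClass_mul_mem_classSpan_iff.1 (hr _ ha' _ hi') l⟩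
  · intro h
    refine ⟨(isBasedSubgroup_iff _).2 ⟨s, rfl⟩, fun r hr m hm => ?_, fun r hr m hm => ?_⟩
    · exact mul_mem_classSpan (fun a ha i hi l => (h a ha i hi l).1) ((hadj r).1 hr) hm
    · exact mul_mem_classSpan (fun i hi a ha l => (h a ha i hi l).2) hm ((hadj r).1 hr)

/-- Unions of degree classes span subbimodules. -/
theorem isBasedSubbimodule_of_deg {s : Set (SimpleClass.{u, v} k H)}
    (h : ∀ i ∈ s, ∀ l, (simplePolygroup k H).deg l = (simplePolygroup k H).deg i → l ∈ s) :
    IsBasedSubbimodule (basic _) (basicDual _) (classSpan k H s) := by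
  refine isBasedSubbimodule_classSpan_iff.2 fun a ha i hi l =>
    ⟨fun hl => h i hi l ?_, fun hl => h i hi l ?_⟩
  · rw [← Polygroup.deg_mul hl, (Polygroup.deg_eq_one _).2 ha, one_mul]
  · rw [← Polygroup.deg_mul hl, (Polygroup.deg_eq_one _).2 ha, mul_one]

/-- Subbimodules are spanned by unions of degree classes. -/
theorem mem_of_deg_eq {s : Set (SimpleClass.{u, v} k H)}
    (hs : IsBasedSubbimodule (basic _) (basicDual _) (classSpan k H s)) {i l : SimpleClass k H}
    (hi : i ∈ s) (h : (simplePolygroup k H).deg i = (simplePolygroup k H).deg l) : l ∈ s := by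
  obtain ⟨a, ha, hl⟩ := (Polygroup.deg_eq_deg _).1 h
  exact (isBasedSubbimodule_classSpan_iff.1 hs a ha i hi l).1 hl

/-- The indecomposable subbimodules are the homogeneous components. -/
theorem isIndecomposableSubbimodule_iff
    {M : AddSubgroup (GrothendieckRing (HopfRep.{u, v} k H))} :
    IsIndecomposableSubbimodule (basic _) (basicDual _) M ↔ ∃ q, M = degSpan q := by
  constructor
  · rintro ⟨hM, hne, hind⟩
    obtain ⟨s, rfl⟩ := (isBasedSubgroup_iff _).1 hM.based
    obtain ⟨i, hi⟩ : s.Nonempty := by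
      rw [Set.nonempty_iff_ne_empty]
      exact fun h => hne (classSpan_eq_bot_iff.2 h)
    let t : Set (SimpleClass k H) := {j | (simplePolygroup k H).deg j = (simplePolygroup k H).deg i}
    have hts : t ⊆ s := fun j hj => mem_of_deg_eq hM hi (Eq.symm hj)
    have h1 : IsBasedSubbimodule (basic _) (basicDual _) (classSpan k H t) :=
      isBasedSubbimodule_of_deg fun j hj l hl => Eq.trans hl hj
    have h2 : IsBasedSubbimodule (basic _) (basicDual _) (classSpan k H (s \ t)) :=
      isBasedSubbimodule_of_deg fun j hj l hl =>
        ⟨mem_of_deg_eq hM hj.1 hl.symm, fun hlt => hj.2 (Eq.trans hl.symm hlt)⟩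
    rcases hind _ _ h1 h2 (by rw [← classSpan_union, Set.union_sdiff_cancel hts])
      (classSpan_inf_eq_bot Set.disjoint_sdiff_right) with h | h
    · exact absurd (classSpan_eq_bot_iff.1 h) (Set.Nonempty.ne_empty ⟨i, rfl⟩)
    · refine ⟨(simplePolygroup k H).deg i, ?_⟩
      have hst : s ⊆ t := Set.sdiff_eq_empty.1 (classSpan_eq_bot_iff.1 h)
      rw [Set.Subset.antisymm hst hts]
      rfl
  · rintro ⟨q, rfl⟩
    have hq : IsBasedSubbimodule (basic _) (basicDual _) (degSpan q) :=
      isBasedSubbimodule_of_deg fun j hj l hl => Eq.trans hl hj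
    obtain ⟨i, hi⟩ := (simplePolygroup k H).deg_surjective q
    refine ⟨hq, fun h => ?_, fun M₁ M₂ h₁ h₂ hsup hinf => ?_⟩
    · exact Set.Nonempty.ne_empty ⟨i, hi⟩ (classSpan_eq_bot_iff.1 h)
    · obtain ⟨s, rfl⟩ := (isBasedSubgroup_iff _).1 h₁.based
      obtain ⟨t, rfl⟩ := (isBasedSubgroup_iff _).1 h₂.based
      by_contra! hcon
      obtain ⟨x, hx⟩ := Set.nonempty_iff_ne_empty.2 fun h => hcon.1 (classSpan_eq_bot_iff.2 h)
      obtain ⟨y, hy⟩ := Set.nonempty_iff_ne_empty.2 fun h => hcon.2 (classSpan_eq_bot_iff.2 h)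
      have hxq : (simplePolygroup k H).deg x = q := objClass_rep_mem_classSpan_iff.1
        (hsup.le (AddSubgroup.mem_sup_left (objClass_mem_classSpan_of_mem hx)))
      have hyq : (simplePolygroup k H).deg y = q := objClass_rep_mem_classSpan_iff.1
        (hsup.le (AddSubgroup.mem_sup_right (objClass_mem_classSpan_of_mem hy)))
      have hys : y ∈ s := mem_of_deg_eq h₁ hx (hxq.trans hyq.symm)
      have : objClass y.rep ∈ classSpan k H s ⊓ classSpan k H t :=
        ⟨objClass_mem_classSpan_of_mem hys, objClass_mem_classSpan_of_mem hy⟩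
      rw [hinf, AddSubgroup.mem_bot] at this
      exact objClass_rep_ne_zero y this

theorem objClass_mem_degSpan_iff {X : HopfRep.{u, v} k H} (hX : Simple X)
    {q : (simplePolygroup k H).GradingGroup} :
    objClass X ∈ degSpan q ↔ (simplePolygroup k H).deg (.mk X hX) = q := by
  rw [← objClass_of_iso (SimpleClass.repMkIso X hX), degSpan, objClass_rep_mem_classSpan_iff]
  rfl

theorem degSpan_injective : Function.Injective (degSpan (k := k) (H := H)) := by
  intro q r h
  obtain ⟨i, rfl⟩ := (simplePolygroup k H).deg_surjective q
  have : objClass i.rep ∈ degSpan ((simplePolygroup k H).deg i) :=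
    objClass_mem_classSpan_of_mem rfl
  rw [h, objClass_mem_degSpan_iff i.simple, SimpleClass.mk_rep] at this
  exact this

variable (k H) in
/-- The components of the Grothendieck ring are indexed by the grading group of the polygroup of
simple representations. -/
noncomputable def universalGradingEquiv :
    (simplePolygroup.{u, v} k H).GradingGroup ≃ UniversalGrading (HopfRep.{u, v} k H) :=
  Equiv.ofBijective (fun q => ⟨degSpan q, isIndecomposableSubbimodule_iff.2 ⟨q, rfl⟩⟩)
    ⟨fun _ _ h => degSpan_injective (congrArg Subtype.val h), fun M => by
      obtain ⟨q, hq⟩ := isIndecomposableSubbimodule_iff.1 M.2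
      exact ⟨q, Subtype.ext hq.symm⟩⟩

theorem component_universalGradingEquiv (q : (simplePolygroup.{u, v} k H).GradingGroup) :
    (universalGradingEquiv k H q).component = degSpan q := rfl

noncomputable instance : Group (UniversalGrading (HopfRep.{u, v} k H)) :=
  (universalGradingEquiv k H).symm.group

instance : Finite (UniversalGrading (HopfRep.{u, v} k H)) :=
  Finite.of_equiv _ (universalGradingEquiv k H)

theorem universalGradingEquiv_mul (q r : (simplePolygroup.{u, v} k H).GradingGroup) :
    universalGradingEquiv k H (q * r) = universalGradingEquiv k H q * universalGradingEquiv k H r :=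
  map_mul (universalGradingEquiv k H).symm.mulEquiv.symm q r

variable (k H) in
theorem isUniversalGradingGroup : IsUniversalGradingGroup (HopfRep.{u, v} k H) := by
  intro a b c
  obtain ⟨p, rfl⟩ := (universalGradingEquiv k H).surjective a
  obtain ⟨q, rfl⟩ := (universalGradingEquiv k H).surjective b
  obtain ⟨r, rfl⟩ := (universalGradingEquiv k H).surjective c
  rw [← universalGradingEquiv_mul, (universalGradingEquiv k H).injective.eq_iff]
  simp only [component_universalGradingEquiv]
  constructor
  · rintro rfl x hx y hy
    refine mul_mem_classSpan (fun i hi j hj l hl => ?_) hx hy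
    rw [Set.mem_ofPred_eq, ← Polygroup.deg_mul hl]
    exact congrArg₂ _ hi hj
  · intro h
    obtain ⟨i, rfl⟩ := (simplePolygroup k H).deg_surjective p
    obtain ⟨j, rfl⟩ := (simplePolygroup k H).deg_surjective q
    obtain ⟨l, hl⟩ := (simplePolygroup k H).nonempty i j
    have := h _ (objClass_mem_classSpan_of_mem (j := i) rfl) _
      (objClass_mem_classSpan_of_mem (j := j) rfl)
    rw [Polygroup.deg_mul hl]
    exact objClass_mul_mem_classSpan_iff.1 this l hl

end Hopf

end HopfRep

/-! ### Central Hopf subalgebras -/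

namespace HopfSubalgebra

open Coalgebra HopfAlgebra

variable {k : Type u} {H : Type v} [Field k] [Ring H] [HopfAlgebra k H] (K : HopfSubalgebra k H)

variable {K} in
/-- Additive statements about `Δ x`, for `x ∈ K`, may be checked on tensors `a ⊗ b` of elements of
`K`. -/
theorem comul_induction {x : H} (hx : x ∈ K) {p : H ⊗[k] H → Prop} (zero : p 0)
    (add : ∀ s t, p s → p t → p (s + t)) (tmul : ∀ a ∈ K, ∀ b ∈ K, p (a ⊗ₜ b)) :
    p (comul (R := k) x) := by
  obtain ⟨t, ht⟩ := K.comul_mem x hx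
  rw [← ht]
  induction t with
  | zero => rw [map_zero]; exact zero
  | add s t hs ht =>
    have key : ∀ t, p (TensorProduct.map K.toSubalgebra.val.toLinearMap
        K.toSubalgebra.val.toLinearMap t) := by
      intro t
      induction t with
      | zero => rw [map_zero]; exact zero
      | add s t hs ht => rw [map_add]; exact add _ _ hs ht
      | tmul a b => exact tmul _ a.2 _ b.2
    exact key _
  | tmul a b => exact tmul _ a.2 _ b.2

variable {K}

theorem IsCentral.augIdeal_isTwoSided (hK : K.IsCentral) : K.augIdeal.IsTwoSided where
  mul_mem_of_left {a} b ha := by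
    induction ha using Submodule.span_induction with
    | zero => rw [zero_mul]; exact zero_mem _
    | add x y _ _ hx hy => rw [add_mul]; exact add_mem hx hy
    | smul c x _ hx => rw [smul_eq_mul, mul_assoc]; exact K.augIdeal.mul_mem_left c hx
    | mem x hx =>
      rw [← hK x hx.1 b]
      exact K.augIdeal.mul_mem_left b (Ideal.subset_span hx)

theorem sub_counit_mem_augIdeal {x : H} (hx : x ∈ K) :
    x - algebraMap k H (counit (R := k) x) ∈ K.augIdeal := by
  refine Ideal.subset_span ⟨K.toSubalgebra.sub_mem hx (K.toSubalgebra.algebraMap_mem _), ?_⟩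
  simp

theorem mk_eq_counit [K.augIdeal.IsTwoSided] {x : H} (hx : x ∈ K) :
    Ideal.Quotient.mkₐ k K.augIdeal x = algebraMap k _ (counit (R := k) x) := by
  rw [← AlgHom.commutes (Ideal.Quotient.mkₐ k K.augIdeal)]
  exact Ideal.Quotient.mk_eq_mk_iff_sub_mem _ _ |>.2 (sub_counit_mem_augIdeal hx)

/-- For a central Hopf subalgebra `K`, the ideal `HK⁺` is a Hopf ideal. Modulo `HK⁺`, the elements
of `K` become scalars, so that `Δ x` becomes `1 ⊗ x` for `x ∈ K`. -/
theorem IsCentral.augIdeal_isHopfIdeal (hK : K.IsCentral) : K.augIdeal.IsHopfIdeal k := by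
  have := hK.augIdeal_isTwoSided
  refine { counit_eq_zero := ?_, map_mkQ_comul_eq_zero := ?_, antipode_mem := ?_ }
  · intro x hx
    replace hx : x ∈ K.augIdeal := hx
    induction hx using Submodule.span_induction with
    | zero => exact map_zero _
    | add x y _ _ hx hy => rw [map_add, hx, hy, add_zero]
    | smul c x _ hx => rw [smul_eq_mul, Bialgebra.counit_mul, hx, mul_zero]
    | mem x hx => exact hx.2
  · let π := Ideal.Quotient.mkₐ k K.augIdeal
    let q : H →ₐ[k] (H ⧸ K.augIdeal) ⊗[k] (H ⧸ K.augIdeal) :=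
      (Algebra.TensorProduct.map π π).comp (Bialgebra.comulAlgHom k H)
    intro x hx
    replace hx : x ∈ K.augIdeal := hx
    change q x = 0
    induction hx using Submodule.span_induction with
    | zero => exact map_zero q
    | add x y _ _ hx hy => rw [map_add, hx, hy, add_zero]
    | smul c x _ hx => rw [smul_eq_mul, map_mul, hx, mul_zero]
    | mem x hx =>
      have key : Algebra.TensorProduct.map π π (comul (R := k) x) =
          1 ⊗ₜ π (TensorProduct.lid k H ((counit (R := k)).rTensor H (comul (R := k) x))) := by
        refine comul_induction (p := fun t => Algebra.TensorProduct.map π π t =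
          1 ⊗ₜ π (TensorProduct.lid k H ((counit (R := k)).rTensor H t))) hx.1 ?_ ?_ ?_
        · simp
        · intro s t hs ht
          simp only [map_add, hs, ht, TensorProduct.tmul_add]
        · intro a ha b hb
          rw [Algebra.TensorProduct.map_tmul, mk_eq_counit ha, LinearMap.rTensor_tmul,
            TensorProduct.lid_tmul, map_smul, TensorProduct.tmul_smul, TensorProduct.smul_tmul',
            Algebra.algebraMap_eq_smul_one]
      rw [rTensor_counit_comul, TensorProduct.lid_tmul, one_smul] at key
      refine key.trans ?_
      have : π x = 0 := (mk_eq_counit hx.1).trans (by rw [hx.2, map_zero])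
      rw [this, TensorProduct.tmul_zero]
  · intro x hx
    induction hx using Submodule.span_induction with
    | zero => rw [map_zero]; exact zero_mem _
    | add x y _ _ hx hy => rw [map_add]; exact add_mem hx hy
    | smul c x _ hx =>
      rw [smul_eq_mul, antipode_mul_antidistrib]
      exact hK.augIdeal_isTwoSided.mul_mem_of_left _ hx
    | mem x hx =>
      refine Ideal.subset_span ⟨K.antipode_mem x hx.1, ?_⟩
      rw [counit_antipode, hx.2]

end HopfSubalgebra

namespace HopfRep

open Coalgebra HopfAlgebra

section Trivial

variable {k : Type u} {H : Type v} [Field k] [Ring H] [HopfAlgebra k H] (K : HopfSubalgebra k H)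

/-- The representations on which a Hopf subalgebra `K` acts through the counit. -/
def IsTrivialOn (X : HopfRep.{u, v} k H) : Prop :=
  ∀ x ∈ K, X.ρ x = counit (R := k) x • 1

variable {K}

theorem IsTrivialOn.of_injective {X Y : HopfRep.{u, v} k H} (hY : IsTrivialOn K Y) (f : X ⟶ Y)
    (hf : Function.Injective (toLin f)) : IsTrivialOn K X :=
  fun x hx => ρ_eq_smul_of_injective f hf (hY x hx)

theorem IsTrivialOn.of_surjective {X Y : HopfRep.{u, v} k H} (hX : IsTrivialOn K X) (f : X ⟶ Y)
    (hf : Function.Surjective (toLin f)) : IsTrivialOn K Y :=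
  fun x hx => ρ_eq_smul_of_surjective f hf (hX x hx)

theorem IsTrivialOn.of_iso {X Y : HopfRep.{u, v} k H} (hX : IsTrivialOn K X) (e : X ≅ Y) :
    IsTrivialOn K Y := fun x hx => ρ_eq_smul_of_iso e (hX x hx)

theorem isTrivialOn_unit : IsTrivialOn K (𝟙_ (HopfRep.{u, v} k H)) := fun x _ => unit_ρ x

theorem IsTrivialOn.tensor_ρ {X : HopfRep.{u, v} k H} (hX : IsTrivialOn K X)
    (Y : HopfRep.{u, v} k H) {x : H} (hx : x ∈ K) :
    (X ⊗ Y).ρ x = TensorProduct.map LinearMap.id (Y.ρ x) := by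
  have key : tensorAct X.ρ Y.ρ (comul (R := k) x) = TensorProduct.map LinearMap.id
      (Y.ρ (TensorProduct.lid k H ((counit (R := k)).rTensor H (comul (R := k) x)))) := by
    refine HopfSubalgebra.comul_induction (p := fun t => tensorAct X.ρ Y.ρ t =
      TensorProduct.map LinearMap.id
        (Y.ρ (TensorProduct.lid k H ((counit (R := k)).rTensor H t)))) hx ?_ ?_ ?_
    · simp
    · intro s t hs ht
      simp only [map_add, hs, ht, TensorProduct.map_add_right]
    · intro a ha b hb
      rw [tensorAct_tmul, hX a ha, LinearMap.rTensor_tmul, TensorProduct.lid_tmul, map_smul,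
        TensorProduct.map_smul_left, TensorProduct.map_smul_right]
      rfl
  rw [rTensor_counit_comul, TensorProduct.lid_tmul, one_smul] at key
  exact key

theorem IsTrivialOn.tensor_ρ_eq_smul {X Y : HopfRep.{u, v} k H} (hX : IsTrivialOn K X) {x : H}
    (hx : x ∈ K) {c : k} (hY : Y.ρ x = c • 1) : (X ⊗ Y).ρ x = c • 1 := by
  rw [hX.tensor_ρ Y hx, hY, TensorProduct.map_smul_right]
  congr 1
  exact TensorProduct.map_id

theorem IsTrivialOn.tensor {X Y : HopfRep.{u, v} k H} (hX : IsTrivialOn K X)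
    (hY : IsTrivialOn K Y) : IsTrivialOn K (X ⊗ Y) :=
  fun x hx => hX.tensor_ρ_eq_smul hx (hY x hx)

theorem dual_ρ_eq_smul {X : HopfRep.{u, v} k H} {x : H} {c : k} (h : X.ρ (antipode k x) = c • 1) :
    (Xᘁ).ρ x = c • 1 := by
  refine LinearMap.ext fun f => LinearMap.ext (M := X.V) fun v => ?_
  refine (dual_ρ X x f v).trans ?_
  rw [h]
  exact map_smul (show Module.Dual k X.V from f) c v

theorem IsTrivialOn.dual {X : HopfRep.{u, v} k H} (hX : IsTrivialOn K X) : IsTrivialOn K (Xᘁ) :=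
  fun x hx => dual_ρ_eq_smul (by rw [hX _ (K.antipode_mem x hx), counit_antipode])

theorem IsTrivialOn.of_isDirectSum {Z X Y : HopfRep.{u, v} k H} (h : IsDirectSum Z X Y)
    (hX : IsTrivialOn K X) (hY : IsTrivialOn K Y) : IsTrivialOn K Z := by
  obtain ⟨i, j, p, q, -, -, -, -, hid⟩ := h
  intro x hx
  ext z
  have h1 : linearMap i (linearMap p z) + linearMap j (linearMap q z) = z :=
    LinearMap.congr_fun (congrArg linearMap hid) z
  rw [← h1, map_add, map_add, ← linearMap_comm i, ← linearMap_comm j, hX x hx, hY x hx]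
  simp

/-- A central Hopf subalgebra acts trivially on `X ⊗ X*`, for simple `X`, because it acts on `X` by
scalars. -/
theorem isTrivialOn_tensor_dual [IsAlgClosed k] (hK : K.IsCentral) {X : HopfRep.{u, v} k H}
    (hX : Simple X) : IsTrivialOn K (X ⊗ Xᘁ) := by
  intro x hx
  have key : tensorAct X.ρ (Xᘁ).ρ (comul (R := k) x) =
      TensorProduct.map (X.ρ (LinearMap.mul' k H ((antipode k).lTensor H (comul (R := k) x))))
        LinearMap.id := by
    refine HopfSubalgebra.comul_induction (p := fun t => tensorAct X.ρ (Xᘁ).ρ t =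
      TensorProduct.map (X.ρ (LinearMap.mul' k H ((antipode k).lTensor H t))) LinearMap.id)
      hx ?_ ?_ ?_
    · simp
    · intro s t hs ht
      simp only [map_add, hs, ht, TensorProduct.map_add_left]
    · intro a ha b hb
      obtain ⟨c, hc⟩ := exists_ρ_eq_smul_of_central hX (hK _ (K.antipode_mem b hb))
      rw [tensorAct_tmul, dual_ρ_eq_smul hc, LinearMap.lTensor_tmul, LinearMap.mul'_apply, map_mul,
        hc, mul_smul_comm, mul_one, TensorProduct.map_smul_left, TensorProduct.map_smul_right]
      rfl
  rw [mul_antipode_lTensor_comul_apply, AlgHom.commutes, Algebra.algebraMap_eq_smul_one,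
    TensorProduct.map_smul_left] at key
  refine key.trans ?_
  congr 1
  exact TensorProduct.map_id

theorem isFusionSubcategory_isTrivialOn (K : HopfSubalgebra k H) :
    IsFusionSubcategory (C := HopfRep.{u, v} k H) (IsTrivialOn K) where
  iso := ⟨fun e h => h.of_iso e⟩
  unit := isTrivialOn_unit
  tensor _ _ hX hY := hX.tensor hY
  dual _ hX := hX.dual
  directSum _ _ _ h hX hY := hX.of_isDirectSum h hY
  subobject _ _ f _ hY := hY.of_injective f (injective_of_mono f)

theorem isTrivialOn_of_adjointSubcategory [IsAlgClosed k] (hK : K.IsCentral)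
    {Y : HopfRep.{u, v} k H} (hY : adjointSubcategory (HopfRep.{u, v} k H) Y) : IsTrivialOn K Y :=
  hY _ (isFusionSubcategory_isTrivialOn K) fun _ hX _ f _ =>
    (isTrivialOn_tensor_dual hK hX).of_injective f (injective_of_mono f)

/-- A central Hopf subalgebra acts trivially on the adjoint part of the polygroup of simple
representations. -/
theorem isTrivialOn_of_adjoint [IsAlgClosed k] [IsSemisimpleRing H] (hK : K.IsCentral)
    {a : SimpleClass.{u, v} k H} (ha : (simplePolygroup k H).Adjoint a) : IsTrivialOn K a.rep := by
  induction ha with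
  | one => exact isTrivialOn_unit.of_iso (SimpleClass.repMkIso _ unit_simple).symm
  | @pair i l h =>
    obtain ⟨f, hf⟩ := h
    have h1 := (isTrivialOn_tensor_dual hK i.simple).of_iso
      (whiskerLeftIso i.rep (SimpleClass.repMkIso _ (dual_simple i.simple)).symm)
    exact h1.of_surjective f (surjective_of_simple l.simple f hf)
  | @mul a b l _ _ h iha ihb =>
    obtain ⟨f, hf⟩ := h
    exact (iha.tensor ihb).of_surjective f (surjective_of_simple l.simple f hf)

/-- An element of a central Hopf subalgebra acts by the same scalar on simple representations of the
same degree. -/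
theorem ρ_eq_smul_of_deg_eq [IsAlgClosed k] [IsSemisimpleRing H] (hK : K.IsCentral)
    {i j : SimpleClass.{u, v} k H} (h : (simplePolygroup k H).deg i = (simplePolygroup k H).deg j)
    {x : H} (hx : x ∈ K) {c : k} (hi : i.rep.ρ x = c • 1) : j.rep.ρ x = c • 1 := by
  obtain ⟨a, ha, f, hf⟩ := (Polygroup.deg_eq_deg _).1 h
  exact ρ_eq_smul_of_surjective f (surjective_of_simple j.simple f hf)
    ((isTrivialOn_of_adjoint hK ha).tensor_ρ_eq_smul hx hi)

/-- A full tensor subcategory contains every object whose simple constituents it contains. -/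
theorem fusionSubcategory_of_constituents [IsSemisimpleRing H]
    {P : ObjectProperty (HopfRep.{u, v} k H)} (hP : IsFusionSubcategory P) {Y : HopfRep.{u, v} k H}
    (h : ∀ j : SimpleClass k H, HasHom Y j.rep → P j.rep) : P Y := by
  induction Y using induction_simple with
  | zero Y hY =>
    exact hP.subobject Y (𝟙_ _) 0
      (mono_of_injective _ (Function.injective_of_subsingleton _)) hP.unit
  | simple Y hY =>
    exact hP.iso.of_iso (SimpleClass.repMkIso Y hY) (h _ ((SimpleClass.hasHom_iff hY _).2 rfl))
  | directSum Z X Y hZ ihX ihY =>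
    exact hP.directSum Z X Y hZ (ihX fun j hj => h j (hj.of_isDirectSum_left hZ))
      (ihY fun j hj => h j (hj.of_isDirectSum_left (isDirectSum_symm hZ)))

/-- The adjoint part of the polygroup lies in the adjoint subcategory. -/
theorem fusionSubcategory_of_adjoint [IsSemisimpleRing H]
    {P : ObjectProperty (HopfRep.{u, v} k H)} (hP : IsFusionSubcategory P)
    (hP' : ∀ (X : HopfRep.{u, v} k H) (_ : Simple X) (Z : HopfRep.{u, v} k H) (f : Z ⟶ X ⊗ Xᘁ),
      Mono f → P Z)
    {a : SimpleClass.{u, v} k H} (ha : (simplePolygroup k H).Adjoint a) : P a.rep := by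
  induction ha with
  | one => exact hP.iso.of_iso (SimpleClass.repMkIso _ unit_simple).symm hP.unit
  | @pair i l h =>
    have h1 : HasHom (i.rep ⊗ (i.rep)ᘁ) l.rep := HasHom.of_iso h
      (whiskerLeftIso i.rep (SimpleClass.repMkIso _ (dual_simple i.simple))) (Iso.refl _)
    obtain ⟨f, hf⟩ := h1.symm l.simple
    exact hP' i.rep i.simple l.rep f (mono_of_injective f (injective_of_simple l.simple f hf))
  | @mul a b l _ _ h iha ihb =>
    obtain ⟨f, hf⟩ := HasHom.symm h l.simple
    exact hP.subobject _ _ f (mono_of_injective f (injective_of_simple l.simple f hf))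
      (hP.tensor _ _ iha ihb)

/-- The representations of `H / HK⁺` are the representations of `H` on which `K` is trivial. -/
theorem essImage_res [K.augIdeal.IsTwoSided] [K.augIdeal.IsHopfIdeal k] :
    (HopfRep.res.{u, v, v} (Bialgebra.Quotient.mkBialgHom (R := k) K.augIdeal)).essImage =
      IsTrivialOn K := by
  funext Y
  apply propext
  constructor
  · rintro ⟨X, ⟨e⟩⟩
    refine IsTrivialOn.of_iso (fun x hx => ?_) e
    change X.ρ (Ideal.Quotient.mkₐ k K.augIdeal x) = _
    rw [HopfSubalgebra.mk_eq_counit hx, AlgHom.commutes, Algebra.algebraMap_eq_smul_one]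
    rfl
  · intro hY
    have hker : ∀ a ∈ K.augIdeal, Y.ρ a = 0 := by
      intro a ha
      induction ha using Submodule.span_induction with
      | zero => exact map_zero _
      | add x y _ _ hx hy => rw [map_add, hx, hy, add_zero]
      | smul c x _ hx => rw [smul_eq_mul, map_mul, hx, mul_zero]
      | mem x hx => rw [hY x hx.1, hx.2, zero_smul]
    exact ⟨{ V := Y.V, ρ := Ideal.Quotient.liftₐ K.augIdeal Y.ρ hker },
      ⟨isoMk (LinearEquiv.refl k Y.V) fun _ => rfl⟩⟩

theorem full_res [K.augIdeal.IsTwoSided] [K.augIdeal.IsHopfIdeal k] :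
    (HopfRep.res.{u, v, v} (Bialgebra.Quotient.mkBialgHom (R := k) K.augIdeal)).Full where
  map_surjective {X Y} f :=
    ⟨⟨f.1, fun h => by
      obtain ⟨a, rfl⟩ := Ideal.Quotient.mk_surjective h
      exact f.2 a⟩, rfl⟩

theorem faithful_res [K.augIdeal.IsTwoSided] [K.augIdeal.IsHopfIdeal k] :
    (HopfRep.res.{u, v, v} (Bialgebra.Quotient.mkBialgHom (R := k) K.augIdeal)).Faithful where
  map_injective {_ _ f g} h := by
    have h' := congrArg linearMap h
    exact Subtype.ext h'

end Trivial

end HopfRep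

/-! ### Functions on the universal grading group -/

namespace HopfRep

open Coalgebra HopfAlgebra

section UniversalGrading

variable {k : Type u} {H : Type v} [Field k] [CharZero k] [Ring H] [HopfAlgebra k H]
  [IsSemisimpleRing H] [Module.Finite k H]

/-- The degree of a simple representation in the universal grading group. -/
noncomputable def degree (X : HopfRep.{u, v} k H) (hX : Simple X) :
    UniversalGrading (HopfRep.{u, v} k H) :=
  universalGradingEquiv k H ((simplePolygroup k H).deg (.mk X hX))

theorem objClass_mem_component_iff {X : HopfRep.{u, v} k H} (hX : Simple X)
    (a : UniversalGrading (HopfRep.{u, v} k H)) :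
    objClass X ∈ a.component ↔ degree X hX = a := by
  obtain ⟨q, rfl⟩ := (universalGradingEquiv k H).surjective a
  rw [component_universalGradingEquiv, objClass_mem_degSpan_iff hX, degree,
    (universalGradingEquiv k H).injective.eq_iff]

theorem exists_degree_eq (a : UniversalGrading (HopfRep.{u, v} k H)) :
    ∃ j : SimpleClass.{u, v} k H, degree j.rep j.simple = a := by
  obtain ⟨q, rfl⟩ := (universalGradingEquiv k H).surjective a
  obtain ⟨j, rfl⟩ := (simplePolygroup k H).deg_surjective q
  exact ⟨j, by rw [degree, SimpleClass.mk_rep]⟩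

theorem degree_mul {X Y Z : HopfRep.{u, v} k H} (hX : Simple X) (hY : Simple Y) (hZ : Simple Z)
    (h : HasHom (X ⊗ Y) Z) : degree X hX * degree Y hY = degree Z hZ := by
  rw [degree, degree, degree, ← universalGradingEquiv_mul]
  congr 1
  exact Polygroup.deg_mul (h.of_iso (tensorIso (SimpleClass.repMkIso X hX).symm
    (SimpleClass.repMkIso Y hY).symm) (SimpleClass.repMkIso Z hZ).symm)

theorem universalGradingEquiv_one : universalGradingEquiv.{u, v} k H 1 = 1 :=
  map_one (universalGradingEquiv k H).symm.mulEquiv.symm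

theorem degree_unit : degree (𝟙_ (HopfRep.{u, v} k H)) unit_simple = 1 :=
  universalGradingEquiv_one

theorem degree_dual {X : HopfRep.{u, v} k H} (hX : Simple X) :
    degree (Xᘁ) (dual_simple hX) = (degree X hX)⁻¹ := by
  rw [eq_inv_iff_mul_eq_one, ← degree_unit]
  exact degree_mul _ _ _ (HasHom.tensorLeft
    ((HasHom.self_of_simple hX).of_iso (Iso.refl X) (ρ_ X).symm))

theorem degree_eq_one_iff (j : SimpleClass.{u, v} k H) :
    degree j.rep j.simple = 1 ↔ (simplePolygroup k H).Adjoint j := by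
  rw [← universalGradingEquiv_one, degree, (universalGradingEquiv k H).injective.eq_iff,
    SimpleClass.mk_rep, Polygroup.deg_eq_one]

theorem exists_ρ_eq_smul_degree (f : FunHopf k (UniversalGrading (HopfRep.{u, v} k H))) :
    ∃ h : H, ∀ (X : HopfRep.{u, v} k H) (hX : Simple X), X.ρ h = (f (degree X hX) : k) • 1 :=
  exists_ρ_eq_smul fun j => f (universalGradingEquiv k H ((simplePolygroup k H).deg j))

/-- The element of `H` that acts by `f(a)` on the simple representations of degree `a`. -/
noncomputable def gradingElement (f : FunHopf k (UniversalGrading (HopfRep.{u, v} k H))) : H :=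
  (exists_ρ_eq_smul_degree f).choose

theorem ρ_gradingElement (f : FunHopf k (UniversalGrading (HopfRep.{u, v} k H)))
    {X : HopfRep.{u, v} k H} (hX : Simple X) :
    X.ρ (gradingElement f) = (f (degree X hX) : k) • 1 :=
  (exists_ρ_eq_smul_degree f).choose_spec X hX

variable (k H) in
/-- Functions on the universal grading group, as an algebra of elements of `H`. -/
noncomputable def gradingAlgHom : FunHopf k (UniversalGrading (HopfRep.{u, v} k H)) →ₐ[k] H :=
  AlgHom.ofLinearMap
    { toFun := gradingElement
      map_add' := fun f g => eq_of_ρ_eq fun X hX => by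
        rw [map_add, ρ_gradingElement _ hX, ρ_gradingElement _ hX, ρ_gradingElement _ hX,
          ← add_smul]
        rfl
      map_smul' := fun c f => eq_of_ρ_eq fun X hX => by
        rw [RingHom.id_apply, map_smul, ρ_gradingElement _ hX, ρ_gradingElement _ hX, smul_smul]
        rfl }
    (eq_of_ρ_eq fun X hX => by
      refine (ρ_gradingElement _ hX).trans ?_
      rw [map_one]
      exact one_smul k _)
    (fun f g => eq_of_ρ_eq fun X hX => by
      refine (ρ_gradingElement _ hX).trans ?_
      refine Eq.trans ?_ (map_mul X.ρ (gradingElement f) (gradingElement g)).symm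
      rw [ρ_gradingElement _ hX, ρ_gradingElement _ hX, smul_mul_smul_comm, one_mul]
      rfl)

theorem ρ_gradingAlgHom (f : FunHopf k (UniversalGrading (HopfRep.{u, v} k H)))
    {X : HopfRep.{u, v} k H} (hX : Simple X) :
    X.ρ (gradingAlgHom k H f) = (f (degree X hX) : k) • 1 := ρ_gradingElement f hX

theorem counit_gradingAlgHom (f : FunHopf k (UniversalGrading (HopfRep.{u, v} k H))) :
    counit (R := k) (gradingAlgHom k H f) = counit (R := k) f := by
  have h1 := ρ_gradingAlgHom f (unit_simple (k := k) (H := H))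
  rw [unit_ρ, degree_unit] at h1
  have h2 := LinearMap.congr_fun h1 (1 : k)
  have h3 : counit (R := k) (gradingAlgHom k H f) * 1 = f 1 * 1 := h2
  rw [mul_one, mul_one] at h3
  exact h3

/-- Since `(Δ f)(a, b) = f(ab)`, the image of `Δ f` in `H ⊗ H` acts by `f(ab)` on the tensor product
of simple representations of degrees `a` and `b`. -/
theorem tensorAct_map_gradingAlgHom (f : FunHopf k (UniversalGrading (HopfRep.{u, v} k H)))
    {X Y : HopfRep.{u, v} k H} (hX : Simple X) (hY : Simple Y) :
    tensorAct X.ρ Y.ρ (Algebra.TensorProduct.map (gradingAlgHom k H) (gradingAlgHom k H)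
      (comul (R := k) f)) = (f (degree X hX * degree Y hY) : k) • 1 := by
  classical
  let := Fintype.ofFinite (UniversalGrading (HopfRep.{u, v} k H))
  have hδ : ∀ a b : UniversalGrading (HopfRep.{u, v} k H),
      tensorAct X.ρ Y.ρ (Algebra.TensorProduct.map (gradingAlgHom k H) (gradingAlgHom k H)
        (FunHopf.delta k a ⊗ₜ FunHopf.delta k b)) =
      ((if degree X hX = a then 1 else 0) * (if degree Y hY = b then 1 else 0) : k) • 1 := by
    intro a b
    rw [Algebra.TensorProduct.map_tmul, tensorAct_tmul, ρ_gradingAlgHom _ hX,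
      ρ_gradingAlgHom _ hY, FunHopf.delta_apply, FunHopf.delta_apply, TensorProduct.map_smul_left,
      TensorProduct.map_smul_right, smul_smul]
    congr 1
    exact TensorProduct.map_id
  change tensorAct X.ρ Y.ρ (Algebra.TensorProduct.map (gradingAlgHom k H) (gradingAlgHom k H)
    (FunHopf.comulMap f)) = _
  rw [FunHopf.comulMap_apply]
  simp only [map_sum, map_smul, hδ, smul_smul, ← Finset.sum_smul]
  congr 1
  rw [Finset.sum_eq_single (degree X hX), Finset.sum_eq_single (degree Y hY)]
  · simp
  · intro b _ hb
    simp [hb.symm]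
  · simp
  · intro a _ ha
    simp [ha.symm]
  · simp

theorem comul_gradingAlgHom (f : FunHopf k (UniversalGrading (HopfRep.{u, v} k H))) :
    Algebra.TensorProduct.map (gradingAlgHom k H) (gradingAlgHom k H) (comul (R := k) f) =
      comul (R := k) (gradingAlgHom k H f) := by
  refine eq_of_tensorAct_eq (k := k) (H := H) fun X Y hX hY => ?_
  rw [tensorAct_map_gradingAlgHom f hX hY, ← tensor_ρ]
  refine Eq.symm (ρ_eq_smul_of_constituents (k := k) (H := H) fun j hj => ?_)
  rw [ρ_gradingAlgHom f j.simple, degree_mul hX hY j.simple hj]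

variable (k H) in
/-- The Hopf algebra homomorphism `Fun(U(Rep H)) → H`. -/
noncomputable def gradingHom : FunHopf k (UniversalGrading (HopfRep.{u, v} k H)) →ₐc[k] H :=
  BialgHom.ofAlgHom (gradingAlgHom k H) (AlgHom.ext counit_gradingAlgHom)
    (AlgHom.ext comul_gradingAlgHom)

theorem ρ_gradingHom (f : FunHopf k (UniversalGrading (HopfRep.{u, v} k H)))
    {X : HopfRep.{u, v} k H} (hX : Simple X) :
    X.ρ (gradingHom k H f) = (f (degree X hX) : k) • 1 := ρ_gradingElement f hX

variable (k H) in
theorem gradingHom_injective : Function.Injective (gradingHom.{u, v} k H) := by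
  intro f g h
  funext a
  obtain ⟨j, rfl⟩ := exists_degree_eq a
  apply eq_of_smul_one_eq j.simple
  rw [← ρ_gradingHom f j.simple, ← ρ_gradingHom g j.simple, h]

theorem antipode_gradingHom (f : FunHopf k (UniversalGrading (HopfRep.{u, v} k H))) :
    antipode k (gradingHom k H f) = gradingHom k H (FunHopf.antipodeMap f) := by
  refine eq_of_ρ_eq (k := k) fun X hX => LinearMap.ext fun x => ?_
  rw [ρ_gradingHom _ hX, ← sub_eq_zero, ← Module.forall_dual_apply_eq_zero_iff k]
  intro g
  have h1 := dual_ρ X (gradingHom k H f) g x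
  rw [ρ_gradingHom f (dual_simple hX), degree_dual] at h1
  rw [map_sub, ← h1, sub_eq_zero]
  exact (map_smul g (f (degree X hX)⁻¹) x).symm

variable (k H) in
/-- The image of `Fun(U(Rep H))` as a Hopf subalgebra of `H`. -/
noncomputable def gradingSubalgebra : HopfSubalgebra k H where
  toSubalgebra := (gradingAlgHom k H).range
  comul_mem := by
    rintro _ ⟨f, rfl⟩
    refine ⟨TensorProduct.map (gradingAlgHom k H).rangeRestrict.toLinearMap
      (gradingAlgHom k H).rangeRestrict.toLinearMap (comul (R := k) f), ?_⟩
    rw [TensorProduct.map_map]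
    exact comul_gradingAlgHom f
  antipode_mem := by
    rintro _ ⟨f, rfl⟩
    exact ⟨FunHopf.antipodeMap f, (antipode_gradingHom f).symm⟩

variable (k H) in
theorem range_gradingHom :
    Set.range (gradingHom.{u, v} k H) = (gradingSubalgebra.{u, v} k H : Set H) := rfl

variable (k H) in
theorem gradingSubalgebra_isCentral : (gradingSubalgebra.{u, v} k H).IsCentral := by
  rintro _ ⟨f, rfl⟩ h
  refine eq_of_ρ_eq (k := k) fun X hX => ?_
  change X.ρ (h * gradingHom k H f) = X.ρ (gradingHom k H f * h)
  rw [map_mul, map_mul, ρ_gradingHom f hX, mul_smul_comm, smul_mul_assoc, mul_one, one_mul]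

/-- Every central Hopf subalgebra is contained in the image of `Fun(U(Rep H))`, since its elements
act on simple representations by scalars that depend on the degree only. -/
theorem le_gradingSubalgebra [IsAlgClosed k] {K : HopfSubalgebra k H} (hK : K.IsCentral) :
    K ≤ gradingSubalgebra.{u, v} k H := by
  intro x hx
  choose r hr using fun a : UniversalGrading (HopfRep.{u, v} k H) => exists_degree_eq a
  choose c hc using fun j : SimpleClass.{u, v} k H =>
    exists_ρ_eq_smul_of_central j.simple (hK x hx)
  refine ⟨fun a => c (r a), eq_of_ρ_eq (k := k) fun X hX => ?_⟩
  refine (ρ_gradingAlgHom _ hX).trans (Eq.symm ?_)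
  refine ρ_eq_smul_of_iso (SimpleClass.repMkIso X hX) ?_
  refine ρ_eq_smul_of_deg_eq hK ?_ hx (hc (r (degree X hX)))
  have := hr (degree X hX)
  rw [degree, degree, (universalGradingEquiv k H).injective.eq_iff, SimpleClass.mk_rep] at this
  exact this

variable (k H) in
theorem maximal_gradingSubalgebra [IsAlgClosed k] :
    Maximal HopfSubalgebra.IsCentral (gradingSubalgebra.{u, v} k H) :=
  ⟨gradingSubalgebra_isCentral k H, fun _ hK _ => le_gradingSubalgebra hK⟩

variable (k H) in
/-- The adjoint subcategory consists of the representations on which the Hopf subalgebra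
`Fun(U(Rep H))` acts trivially: a simple representation of this kind has degree `1`. -/
theorem isTrivialOn_gradingSubalgebra [IsAlgClosed k] :
    IsTrivialOn (gradingSubalgebra.{u, v} k H) = adjointSubcategory (HopfRep.{u, v} k H) := by
  funext Y
  apply propext
  constructor
  · intro hY P hP hP'
    refine fusionSubcategory_of_constituents hP fun j hj =>
      fusionSubcategory_of_adjoint hP hP' ((degree_eq_one_iff j).1 ?_)
    obtain ⟨f, hf⟩ := hj
    have hj := hY.of_surjective f (surjective_of_simple j.simple f hf)
    have h1 := hj _ ⟨FunHopf.delta k 1, rfl⟩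
    rw [AlgHom.toRingHom_eq_coe, RingHom.coe_coe] at h1
    rw [ρ_gradingAlgHom _ j.simple, counit_gradingAlgHom] at h1
    have h2 := eq_of_smul_one_eq j.simple h1
    rw [FunHopf.delta_apply, FunHopf.counit_delta, if_pos rfl] at h2
    by_contra hne
    rw [if_neg hne] at h2
    exact zero_ne_one h2
  · exact isTrivialOn_of_adjointSubcategory (gradingSubalgebra_isCentral k H)

end UniversalGrading

end HopfRep

theorem theorem3p6 {k : Type u} [Field k] [IsAlgClosed k] [CharZero k]
    {H : Type v} [Ring H] [HopfAlgebra k H] [IsSemisimpleRing H] :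
    ∃ K : HopfSubalgebra k H,
      -- `K` is the unique maximal Hopf subalgebra contained in the center of `H`
      (Maximal HopfSubalgebra.IsCentral K ∧
        ∀ K' : HopfSubalgebra k H, Maximal HopfSubalgebra.IsCentral K' → K' = K) ∧
      -- `HK⁺` is a Hopf ideal, and `Rep(H)_ad = Rep(H / HK⁺)` as subcategories of `Rep(H)`
      (∃ (_ : K.augIdeal.IsTwoSided) (_ : K.augIdeal.IsHopfIdeal k),
        (HopfRep.res (Bialgebra.Quotient.mkBialgHom (R := k) K.augIdeal)).Full ∧
        (HopfRep.res (Bialgebra.Quotient.mkBialgHom (R := k) K.augIdeal)).Faithful ∧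
        (HopfRep.res (Bialgebra.Quotient.mkBialgHom (R := k) K.augIdeal)).essImage =
          adjointSubcategory (HopfRep.{u, v} k H)) ∧
      -- `K = Fun(U(Rep H))`, where a function `f` acts on simple objects of degree `a` as `f(a)`
      (∃ (_ : Group (UniversalGrading (HopfRep.{u, v} k H)))
          (_ : Finite (UniversalGrading (HopfRep.{u, v} k H))),
        IsUniversalGradingGroup (HopfRep.{u, v} k H) ∧
        ∃ φ : FunHopf k (UniversalGrading (HopfRep.{u, v} k H)) →ₐc[k] H,
          Function.Injective φ ∧ Set.range φ = (K : Set H) ∧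
          ∀ (f : FunHopf k (UniversalGrading (HopfRep.{u, v} k H)))
            (a : UniversalGrading (HopfRep.{u, v} k H)) (X : HopfRep.{u, v} k H),
            Simple X → objClass X ∈ a.component →
              X.ρ (φ f) = (f a : k) • (1 : Module.End k X.V)) := by
  have : Module.Finite k H := finite_of_isSemisimpleRing k H
  have h2 := (HopfRep.gradingSubalgebra_isCentral.{u, v} k H).augIdeal_isTwoSided
  have hHopf := (HopfRep.gradingSubalgebra_isCentral.{u, v} k H).augIdeal_isHopfIdeal
  refine ⟨HopfRep.gradingSubalgebra.{u, v} k H, ⟨HopfRep.maximal_gradingSubalgebra k H,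
    fun K' hK' => ?_⟩, ⟨h2, hHopf, HopfRep.full_res, HopfRep.faithful_res, ?_⟩,
    inferInstance, inferInstance, HopfRep.isUniversalGradingGroup k H, HopfRep.gradingHom k H,
    HopfRep.gradingHom_injective k H, HopfRep.range_gradingHom k H, fun f a X hX ha => ?_⟩
  · exact le_antisymm (HopfRep.le_gradingSubalgebra hK'.prop)
      (hK'.2 (HopfRep.gradingSubalgebra_isCentral k H) (HopfRep.le_gradingSubalgebra hK'.prop))
  · rw [HopfRep.essImage_res, HopfRep.isTrivialOn_gradingSubalgebra]
  · rw [HopfRep.ρ_gradingHom f hX, (HopfRep.objClass_mem_component_iff hX a).1 ha]
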